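/- For $f\in L^1(\mathbb{R}^2)$ write $\hat f(\xi)=\int_{\mathbb{R}^2}e^{-i\xi\cdot z}f(z)\,dz$, and for $G\in L^1(\mathbb{R}^2)$ write $\mathcal F^{-1}G(z)=(2\pi)^{-2}\int_{\mathbb{R}^2}e^{iz\cdot\xi}G(\xi)\,d\xi$. For $\gamma>0$ and $1\le p\le\infty$ let $e^{-\gamma|z|^2}L^p(\mathbb{R}^2)$ be the space of measurable functions $f:\mathbb{R}^2\to\mathbb{C}$ with $e^{\gamma|z|^2}f\in L^p(\mathbb{R}^2)$. Let $\gamma>0$, let $\lambda\in\mathbb{R}\setminus\{0\}$, and let $f\in e^{-\gamma|z|^2}L^2(\mathbb{R}^2)\cap e^{-\gamma|z|^2}L^1(\mathbb{R}^2)$. Assume that $\hat f$ vanishes on the circle $\{\xi\in\mathbb{R}^2: |\xi|=|\lambda|\}$. Then the function $\xi\mapsto \hat f(\xi)/(|\xi|^2-\lambda^2)$, which is defined for $|\xi|\neq|\lambda|$ and hence almost everywhere, is integrable on $\mathbb{R}^2$, and $$\mathcal F^{-1}_{\xi\to z}\Big(\frac{\hat f(\xi)}{|\xi|^2-\lambda^2}\Big)\in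 e^{-\gamma|z|^2}L^\infty(\mathbb{R}^2).$$ -/

import Mathlib

open MeasureTheory
open scoped ENNReal

noncomputable section

/-- The plane `ℝ²` with its Euclidean norm and Lebesgue measure. -/
abbrev Plane : Type := EuclideanSpace ℝ (Fin 2)

/-- The Fourier transform `∫ e^{-i ξ·z} f(z) dz`, in the normalisation without `2π` in the
exponent; it is used for integrable functions only. -/
def fourierPlane (f : Plane → ℂ) (ξ : Plane) : ℂ :=
  ∫ z : Plane, Complex.exp (-Complex.I * ((inner ℝ ξ z : ℝ) : ℂ)) * f z

/-- The inverse Fourier transform `(2π)⁻² ∫ e^{i z·ξ} F(ξ) dξ`; it is used for integrable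
functions only. -/
def fourierInvPlane (F : Plane → ℂ) (z : Plane) : ℂ :=
  (1 / (2 * (Real.pi : ℂ)) ^ 2) *
    ∫ ξ : Plane, Complex.exp (Complex.I * ((inner ℝ z ξ : ℝ) : ℂ)) * F ξ

/-- The weighted space `e^{-γ|z|²} L^p(ℝ²)`: the functions `f` with `e^{γ|z|²} f ∈ L^p(ℝ²)`. -/
def gaussianLp (γ : ℝ) (p : ℝ≥0∞) : Set (Plane → ℂ) :=
  {f | MemLp (fun z : Plane => ((Real.exp (γ * ‖z‖ ^ 2) : ℝ) : ℂ) * f z) p volume}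

end

/-! Gaussian decay makes `planeExt f`, the transform at complex frequencies, entire on ℂ². It
vanishes on the complexified circle w² + t² = λ², not only on the real one
(`planeExt_eq_zero_of_sq_add_sq`), so for almost every real t the quotient by w² + t² - λ² is entire
in w.

By rotation invariance the inverse transform need only be estimated at (r, 0). Moving the first
frequency from ℝ to ℝ + iη gains e^{-rη} (`integral_planeExt_div_shift`), while the numerator grows
like E = e^{η²/(4γ)}. The choice η = 2γr minimises the product and leaves exactly e^{-γr²}.

No further loss in η is allowed, so the integral of the shifted quotient must be O(E) uniformly in η
≥ 1 (`lintegral_planeExt_div_le`). Near the zeros of the shifted symbol the numerator is bounded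
pointwise by E and the singularity is integrable. Elsewhere the arithmetic-geometric mean inequality
separates the numerator, controlled in L² by Plancherel, from the inverse square of the symbol,
which is integrable there. Small |z| is covered by integrability of the quotient on the real plane.
-/

/-! ### Plancherel, contour shift and division of zeros -/

open FourierTransform SchwartzMap ContDiff in
/-- Plancherel's theorem for the integral Fourier transform on `L¹ ∩ L²`. -/
theorem eLpNorm_fourier_eq_of_memLp {V : Type*} [NormedAddCommGroup V] [InnerProductSpace ℝ V]
    [FiniteDimensional ℝ V] [MeasurableSpace V] [BorelSpace V] {h : V → ℂ}
    (h1 : Integrable h) (h2 : MemLp h 2) :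
    eLpNorm (𝓕 h) 2 volume = eLpNorm h 2 volume := by
  set H : Lp ℂ 2 (volume : Measure V) := 𝓕 (h2.toLp h) with hH
  have hcont : Continuous (𝓕 h) :=
    VectorFourier.fourierIntegral_continuous Real.continuous_fourierChar
      (innerSL ℝ).continuous₂ h1
  -- The L² and the integral transforms agree as distributions: in both, the multiplication formula
  -- moves the transform onto the test function.
  have key : ∀ u : 𝓢(V, ℂ), ∫ x, u x • H x = ∫ x, u x • 𝓕 h x := by
    intro u
    have e1 := congrArg (fun T => T u) (Lp.fourier_toTemperedDistribution_eq (h2.toLp h))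
    simp only [TemperedDistribution.fourier_apply, Lp.toTemperedDistribution_apply] at e1
    rw [hH, ← e1]
    have e2 := VectorFourier.integral_fourierIntegral_smul_eq_flip (μ := (volume : Measure V))
      (ν := (volume : Measure V)) (L := innerₗ V) (f := u) (g := h)
      Real.continuous_fourierChar continuous_inner u.integrable h1
    rw [flip_innerₗ] at e2
    have e3 : ∫ x, (𝓕 u) x • (h2.toLp h) x = ∫ x, (𝓕 u) x • h x := by
      apply integral_congr_ae
      filter_upwards [h2.coeFn_toLp] with x hx
      rw [hx]
    rw [e3]
    exact e2
  have hae : ∀ᵐ x, H x = 𝓕 h x := by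
    apply ae_eq_of_integral_contDiff_smul_eq
    · exact (Lp.memLp H).locallyIntegrable (by norm_num)
    · exact hcont.locallyIntegrable
    · intro g hg hc
      have hg₁ : HasCompactSupport (Complex.ofRealCLM ∘ g) := hc.comp_left rfl
      have hg₂ : ContDiff ℝ ∞ (Complex.ofRealCLM ∘ g) := by fun_prop
      simpa using key (hg₁.toSchwartzMap hg₂)
  rw [← eLpNorm_congr_ae hae]
  have : ‖H‖ = ‖h2.toLp h‖ := Lp.norm_fourier_eq _
  rw [Lp.norm_def, Lp.norm_def, ENNReal.toReal_eq_toReal_iff' (Lp.eLpNorm_ne_top _)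
    (Lp.eLpNorm_ne_top _)] at this
  rw [this, eLpNorm_congr_ae h2.coeFn_toLp]

open Filter Topology in
/-- Shifting the contour of integration from `ℝ` to `ℝ + iη` for an entire function that decays
quadratically in the strip between the two lines. -/
theorem integral_eq_integral_add_mul_I_of_decay {H : ℂ → ℂ} (hH : Differentiable ℂ H) {η C X : ℝ}
    (hη : 0 ≤ η) (hX : 0 < X)
    (hdec : ∀ w : ℂ, 0 ≤ w.im → w.im ≤ η → X ≤ |w.re| → ‖H w‖ ≤ C / w.re ^ 2) :
    ∫ x : ℝ, H x = ∫ x : ℝ, H (x + η * Complex.I) := by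
  have hint : ∀ y : ℝ, 0 ≤ y → y ≤ η → Integrable (fun x : ℝ => H (x + y * Complex.I)) := by
    intro y hy0 hy
    have hc : Continuous (fun x : ℝ => H (x + y * Complex.I)) := by
      have := hH.continuous
      fun_prop
    have hb : ∀ x : ℝ, X ≤ |x| → ‖H (x + y * Complex.I)‖ ≤ C / x ^ 2 := by
      intro x hx
      simpa using hdec (x + y * Complex.I) (by simpa using hy0) (by simpa using hy)
        (by simpa using hx)
    refine hc.locallyIntegrable.integrable_of_isBigO_cocompact
      (g := fun x : ℝ => (1 + x ^ 2)⁻¹) ?_ (integrable_inv_one_add_sq.integrableAtFilter _)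
    -- For |x| ≥ X, 1 + x² ≤ (1 + 1/X²) x².
    refine Asymptotics.IsBigO.of_bound (C * (1 + 1 / X ^ 2)) ?_
    have : ∀ᶠ x : ℝ in cocompact ℝ, X ≤ |x| :=
      (tendsto_norm_cocompact_atTop (E := ℝ)).eventually_ge_atTop X
    filter_upwards [this] with x hx
    have hx0 : 0 < |x| := hX.trans_le hx
    have hxx : X ^ 2 ≤ x ^ 2 := by rw [← sq_abs x]; gcongr
    have hx2 : 0 < x ^ 2 := by rw [← sq_abs x]; positivity
    have hC : 0 ≤ C := by
      have := (norm_nonneg _).trans (hb x hx)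
      by_contra hneg
      exact absurd this (not_le.2 (div_neg_of_neg_of_pos (not_le.1 hneg) hx2))
    refine (hb x hx).trans ?_
    rw [Real.norm_of_nonneg (by positivity), mul_assoc, div_eq_mul_inv]
    refine mul_le_mul_of_nonneg_left ?_ hC
    rw [← div_eq_mul_inv, le_div_iff₀ (by positivity), inv_mul_le_iff₀ hx2]
    have : 1 ≤ x ^ 2 * (1 / X ^ 2) := by
      rw [mul_one_div, le_div_iff₀ (by positivity)]
      linarith
    nlinarith
  have hi0 : Integrable (fun x : ℝ => H x) := by simpa using hint 0 le_rfl hη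
  have hi1 := hint η hη le_rfl
  have t0 := intervalIntegral_tendsto_integral hi0 tendsto_neg_atTop_atBot tendsto_id
  have t1 := intervalIntegral_tendsto_integral hi1 tendsto_neg_atTop_atBot tendsto_id
  have hvert : ∀ s : ℝ, |s| = 1 →
      Tendsto (fun T : ℝ => ∫ y in (0 : ℝ)..η, H ((s * T : ℝ) + y * Complex.I)) atTop (𝓝 0) := by
    intro s hs
    have lim : Tendsto (fun T : ℝ => C / T ^ 2 * |η - 0|) atTop (𝓝 0) := by
      have : Tendsto (fun T : ℝ => C / T ^ 2) atTop (𝓝 0) :=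
        tendsto_const_nhds.div_atTop (tendsto_pow_atTop two_ne_zero)
      simpa using this.mul_const |η - 0|
    refine squeeze_zero_norm' ?_ lim
    filter_upwards [eventually_ge_atTop X] with T hT
    apply intervalIntegral.norm_integral_le_of_norm_le_const
    intro y hy
    rw [Set.uIoc_of_le hη] at hy
    have hs2 : s ^ 2 = 1 := by rw [← sq_abs, hs, one_pow]
    have := hdec ((s * T : ℝ) + y * Complex.I) (by simpa using hy.1.le) (by simpa using hy.2)
      (by
        have : |s * T| = T := by rw [abs_mul, hs, one_mul, abs_of_pos (hX.trans_le hT)]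
        simp only [Complex.add_re, Complex.ofReal_re, Complex.mul_re, Complex.I_re, mul_zero,
          Complex.ofReal_im, Complex.I_im, mul_one, sub_self, add_zero]
        rw [this]; exact hT)
    refine this.trans (le_of_eq ?_)
    simp [mul_pow, hs2]
  have hrect : ∀ T : ℝ, (∫ x in (-T)..T, H x) = (∫ x in (-T)..T, H (x + η * Complex.I))
      - Complex.I * (∫ y in (0 : ℝ)..η, H ((1 * T : ℝ) + y * Complex.I))
      + Complex.I * (∫ y in (0 : ℝ)..η, H (((-1) * T : ℝ) + y * Complex.I)) := by
    intro T
    have := Complex.integral_boundary_rect_eq_zero_of_differentiableOn H (-T : ℂ) (T + η * Complex.I)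
      hH.differentiableOn
    simp at this
    simp
    linear_combination this
  have hlim : Tendsto (fun T : ℝ => ∫ x in (-T)..T, H x) atTop
      (𝓝 ((∫ x : ℝ, H (x + η * Complex.I)) - Complex.I * 0 + Complex.I * 0)) := by
    simp_rw [hrect]
    exact (t1.sub ((hvert 1 (by simp)).const_mul _)).add ((hvert (-1) (by simp)).const_mul _)
  simpa using tendsto_nhds_unique t0 hlim

/-- Two simple zeros of an entire function can be divided out. -/
theorem exists_differentiable_eq_div_sq_sub_sq {F : ℂ → ℂ} (hF : Differentiable ℂ F) {a : ℂ}
    (ha : a ≠ 0) (h1 : F a = 0) (h2 : F (-a) = 0) :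
    ∃ G : ℂ → ℂ, Differentiable ℂ G ∧
      ∀ w, w ≠ a → w ≠ -a → G w = F w / (w ^ 2 - a ^ 2) := by
  have hd : ∀ {K : ℂ → ℂ} (c : ℂ), Differentiable ℂ K → Differentiable ℂ (dslope K c) := by
    intro K c hK
    rw [← differentiableOn_univ] at hK ⊢
    exact (Complex.differentiableOn_dslope Filter.univ_mem).2 hK
  -- As -a ≠ a, the first quotient still vanishes at -a and can be divided again.
  refine ⟨dslope (dslope F a) (-a), hd _ (hd _ hF), fun w hw hw' => ?_⟩
  have hne : -a ≠ a := by
    intro h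
    exact ha (self_eq_neg.1 h.symm)
  rw [dslope_of_ne _ hw', slope_def_field, dslope_of_ne _ hne, dslope_of_ne _ hw, slope_def_field,
    slope_def_field, h1, h2]
  have e1 : w - a ≠ 0 := sub_ne_zero.2 hw
  have e2 : w + a ≠ 0 := by rw [← sub_neg_eq_add]; exact sub_ne_zero.2 hw'
  have e3 : w ^ 2 - a ^ 2 = (w - a) * (w + a) := by ring
  rw [e3, sub_neg_eq_add]
  simp only [sub_zero, zero_div]
  field_simp

/-! ### The entire extension of the Fourier transform -/

theorem norm_mul_add_mul_le (a b x y : ℝ) : |a * x + b * y| ≤ (|a| + |b|) * √(x ^ 2 + y ^ 2) := by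
  have hx : |x| ≤ √(x ^ 2 + y ^ 2) := Real.abs_le_sqrt (by nlinarith [sq_nonneg y])
  have hy : |y| ≤ √(x ^ 2 + y ^ 2) := Real.abs_le_sqrt (by nlinarith [sq_nonneg x])
  calc |a * x + b * y| ≤ |a * x| + |b * y| := abs_add_le _ _
    _ = |a| * |x| + |b| * |y| := by rw [abs_mul, abs_mul]
    _ ≤ _ := by rw [add_mul]; gcongr

theorem Plane.norm_eq (z : Plane) : ‖z‖ = √(z 0 ^ 2 + z 1 ^ 2) := by
  rw [EuclideanSpace.norm_eq]; simp

theorem Plane.norm_sq_eq (z : Plane) : ‖z‖ ^ 2 = z 0 ^ 2 + z 1 ^ 2 := by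
  rw [Plane.norm_eq, Real.sq_sqrt (by positivity)]

theorem Plane.inner_eq (x z : Plane) : inner ℝ x z = x 0 * z 0 + x 1 * z 1 := by
  simp [PiLp.inner_apply, mul_comm]

theorem Differentiable.comp_uncurried {P : ℂ → ℂ → ℂ}
    (hP : Differentiable ℂ (fun p : ℂ × ℂ => P p.1 p.2)) {a b : ℂ → ℂ} (ha : Differentiable ℂ a)
    (hb : Differentiable ℂ b) : Differentiable ℂ (fun θ => P (a θ) (b θ)) :=
  hP.comp (ha.prodMk hb)

/-- The extension of the Fourier transform to complex frequencies. -/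
noncomputable def planeExt (f : Plane → ℂ) (w t : ℂ) : ℂ :=
  ∫ z : Plane, Complex.exp (-Complex.I * (w * (z 0 : ℂ) + t * (z 1 : ℂ))) * f z

theorem fourierPlane_eq_planeExt (f : Plane → ℂ) (ξ : Plane) :
    fourierPlane f ξ = planeExt f (ξ 0 : ℝ) (ξ 1 : ℝ) := by
  unfold fourierPlane planeExt
  congr 1; ext z
  rw [Plane.inner_eq]; push_cast; rfl

/-- The norm in `e^{-γ|z|²}L¹`. -/
noncomputable def gaussianNormOne (γ : ℝ) (f : Plane → ℂ) : ℝ :=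
  ∫ z : Plane, Real.exp (γ * ‖z‖ ^ 2) * ‖f z‖

section

variable {γ : ℝ} {f : Plane → ℂ}

theorem gaussianLp.aestronglyMeasurable {p : ℝ≥0∞} (hf : f ∈ gaussianLp γ p) :
    AEStronglyMeasurable f volume := by
  have h : AEStronglyMeasurable (fun z : Plane => ((Real.exp (-(γ * ‖z‖ ^ 2)) : ℝ) : ℂ))
      volume := Continuous.aestronglyMeasurable (by fun_prop)
  refine (h.mul (MemLp.aestronglyMeasurable hf)).congr (Filter.Eventually.of_forall fun z => ?_)
  simp only [Pi.mul_apply]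
  rw [← mul_assoc, ← Complex.ofReal_mul, ← Real.exp_add]
  simp

theorem gaussianLp.integrable_exp_mul_norm (hf : f ∈ gaussianLp γ 1) :
    Integrable (fun z : Plane => Real.exp (γ * ‖z‖ ^ 2) * ‖f z‖) := by
  have := (memLp_one_iff_integrable.1 hf).norm
  refine this.congr (Filter.Eventually.of_forall fun z => ?_)
  simp only [norm_mul, Complex.norm_real, Real.norm_eq_abs, Real.abs_exp]

/-- Multipliers of exponential growth keep `e^{-γ|z|²}L¹` inside `L¹`. -/
theorem gaussianLp.integrable_mul_of_le (hf : f ∈ gaussianLp γ 1) {K : ℝ} {m : Plane → ℂ}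
    (hm : AEStronglyMeasurable m volume) (hb : ∀ z, ‖m z‖ ≤ K * Real.exp (γ * ‖z‖ ^ 2)) :
    Integrable (fun z => m z * f z) := by
  refine ((gaussianLp.integrable_exp_mul_norm hf).const_mul K).mono'
    (hm.mul (gaussianLp.aestronglyMeasurable hf)) (Filter.Eventually.of_forall fun z => ?_)
  simp only [norm_mul]
  rw [← mul_assoc]
  gcongr
  exact hb z

/-- Completing the square. This is the source of the growth rate η²/(4γ) of the transform in
imaginary directions. -/
theorem exp_mul_le_exp_mul_sq (hγ : 0 < γ) (c s : ℝ) :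
    Real.exp (c * s) ≤ Real.exp (c ^ 2 / (4 * γ)) * Real.exp (γ * s ^ 2) := by
  rw [← Real.exp_add, Real.exp_le_exp, ← sub_nonneg]
  have : c ^ 2 / (4 * γ) + γ * s ^ 2 - c * s = (c - 2 * γ * s) ^ 2 / (4 * γ) := by
    field_simp; ring
  rw [this]; positivity

theorem norm_exp_planeExt (w t : ℂ) (z : Plane) :
    ‖Complex.exp (-Complex.I * (w * (z 0 : ℂ) + t * (z 1 : ℂ)))‖ =
      Real.exp (w.im * z 0 + t.im * z 1) := by
  rw [Complex.norm_exp]; simp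

theorem exp_im_le (hγ : 0 < γ) (w t : ℂ) (z : Plane) :
    Real.exp (w.im * z 0 + t.im * z 1) ≤
      Real.exp ((|w.im| + |t.im|) ^ 2 / (4 * γ)) * Real.exp (γ * ‖z‖ ^ 2) := by
  refine le_trans ?_ (exp_mul_le_exp_mul_sq hγ _ _)
  rw [Real.exp_le_exp, Plane.norm_eq]
  exact (le_abs_self _).trans (norm_mul_add_mul_le _ _ _ _)

theorem integrable_planeExt (hγ : 0 < γ) (hf : f ∈ gaussianLp γ 1) (w t : ℂ) :
    Integrable (fun z : Plane =>
      Complex.exp (-Complex.I * (w * (z 0 : ℂ) + t * (z 1 : ℂ))) * f z) := by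
  refine gaussianLp.integrable_mul_of_le hf (Continuous.aestronglyMeasurable (by fun_prop))
    (fun z => ?_) (K := Real.exp ((|w.im| + |t.im|) ^ 2 / (4 * γ)))
  rw [norm_exp_planeExt]
  exact exp_im_le hγ w t z

theorem norm_planeExt_le (hγ : 0 < γ) (hf : f ∈ gaussianLp γ 1) (w : ℂ) (t : ℝ) :
    ‖planeExt f w t‖ ≤ Real.exp (w.im ^ 2 / (4 * γ)) * gaussianNormOne γ f := by
  unfold planeExt gaussianNormOne
  rw [← integral_const_mul]
  refine norm_integral_le_of_norm_le ((gaussianLp.integrable_exp_mul_norm hf).const_mul _)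
    (Filter.Eventually.of_forall fun z => ?_)
  rw [norm_mul, norm_exp_planeExt, ← mul_assoc]
  gcongr
  simpa using exp_im_le hγ w t z

theorem differentiable_planeExt (hγ : 0 < γ) (hf : f ∈ gaussianLp γ 1) :
    Differentiable ℂ (fun p : ℂ × ℂ => planeExt f p.1 p.2) := by
  intro p₀
  set L : Plane → ℂ × ℂ →L[ℂ] ℂ := fun z =>
    (-Complex.I) • ((z 0 : ℂ) • ContinuousLinearMap.fst ℂ ℂ ℂ
      + (z 1 : ℂ) • ContinuousLinearMap.snd ℂ ℂ ℂ) with hL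
  have hLn : ∀ z, ‖L z‖ ≤ 2 * ‖z‖ := by
    intro z
    have h0 : |z 0| ≤ ‖z‖ := by
      rw [Plane.norm_eq]; exact Real.abs_le_sqrt (by nlinarith [sq_nonneg (z 1)])
    have h1 : |z 1| ≤ ‖z‖ := by
      rw [Plane.norm_eq]; exact Real.abs_le_sqrt (by nlinarith [sq_nonneg (z 0)])
    calc ‖L z‖ ≤ ‖(z 0 : ℂ) • ContinuousLinearMap.fst ℂ ℂ ℂ‖
        + ‖(z 1 : ℂ) • ContinuousLinearMap.snd ℂ ℂ ℂ‖ := by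
          rw [hL]; simp only [norm_smul, norm_neg, Complex.norm_I, one_mul]
          refine (norm_add_le _ _).trans (le_of_eq ?_)
          simp only [norm_smul]
      _ ≤ |z 0| * 1 + |z 1| * 1 := by
          rw [norm_smul, norm_smul, Complex.norm_real, Complex.norm_real]
          gcongr
          · exact le_rfl
          · exact ContinuousLinearMap.norm_fst_le _ _ _
          · exact le_rfl
          · exact ContinuousLinearMap.norm_snd_le _ _ _
      _ ≤ _ := by linarith
  have hLc : Continuous L := by
    rw [hL]; fun_prop
  set c : ℝ := ‖p₀‖ + 1 with hc
  have hcpos : 0 < c := by positivity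
  have hball : ∀ p ∈ Metric.ball p₀ 1, ∀ z : Plane,
      ‖Complex.exp (-Complex.I * (p.1 * (z 0 : ℂ) + p.2 * (z 1 : ℂ)))‖ ≤
        Real.exp (2 * c * ‖z‖) := by
    intro p hp z
    have hpn : ‖p‖ ≤ c := by
      have := norm_le_norm_add_norm_sub' p p₀
      rw [Metric.mem_ball, dist_eq_norm] at hp
      linarith
    have h1 : |p.1.im| ≤ c := (Complex.abs_im_le_norm _).trans ((norm_fst_le p).trans hpn)
    have h2 : |p.2.im| ≤ c := (Complex.abs_im_le_norm _).trans ((norm_snd_le p).trans hpn)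
    rw [norm_exp_planeExt, Real.exp_le_exp]
    refine (le_abs_self _).trans ((norm_mul_add_mul_le _ _ _ _).trans ?_)
    rw [← Plane.norm_eq]
    gcongr
    linarith
  have key := hasFDerivAt_integral_of_dominated_of_fderiv_le (𝕜 := ℂ)
    (μ := (volume : Measure Plane))
    (F := fun (p : ℂ × ℂ) z => Complex.exp (-Complex.I * (p.1 * (z 0 : ℂ) + p.2 * (z 1 : ℂ))) * f z)
    (F' := fun p z =>
      (Complex.exp (-Complex.I * (p.1 * (z 0 : ℂ) + p.2 * (z 1 : ℂ))) * f z) • L z)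
    -- The factor 2‖z‖ from `L z` is absorbed through ‖z‖ ≤ e^{‖z‖}, whence 2c + 1; any exponential
    -- of linear growth is dominated by the Gaussian weight.
    (bound := fun z => 2 * Real.exp ((2 * c + 1) * ‖z‖) * ‖f z‖)
    (x₀ := p₀) (Metric.ball_mem_nhds p₀ one_pos)
    (Filter.Eventually.of_forall fun p =>
      (integrable_planeExt hγ hf p.1 p.2).aestronglyMeasurable)
    (integrable_planeExt hγ hf p₀.1 p₀.2)
    ((integrable_planeExt hγ hf p₀.1 p₀.2).aestronglyMeasurable.smul hLc.aestronglyMeasurable)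
    (Filter.Eventually.of_forall fun z p hp => ?_) ?_
    (Filter.Eventually.of_forall fun z p hp => ?_)
  · exact key.differentiableAt
  · rw [norm_smul, norm_mul]
    have e := hball p hp z
    have e2 : ‖z‖ ≤ Real.exp ‖z‖ := by linarith [Real.add_one_le_exp ‖z‖]
    calc _ ≤ Real.exp (2 * c * ‖z‖) * ‖f z‖ * (2 * Real.exp ‖z‖) := by
          gcongr
          exact (hLn z).trans (by linarith)
      _ = _ := by
          rw [add_mul, Real.exp_add, one_mul]; ring
  · have := gaussianLp.integrable_mul_of_le hf (K := 2 * Real.exp ((2 * c + 1) ^ 2 / (4 * γ)))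
      (m := fun z => ((2 * Real.exp ((2 * c + 1) * ‖z‖) : ℝ) : ℂ))
      (Continuous.aestronglyMeasurable (by fun_prop)) (fun z => by
        rw [Complex.norm_real, Real.norm_of_nonneg (by positivity), mul_assoc]
        gcongr
        exact exp_mul_le_exp_mul_sq hγ _ _)
    refine this.norm.congr (Filter.Eventually.of_forall fun z => ?_)
    beta_reduce
    rw [norm_mul, Complex.norm_real, Real.norm_of_nonneg (by positivity)]
  · have h1 : HasFDerivAt (fun p : ℂ × ℂ =>
        -Complex.I * (p.1 * (z 0 : ℂ) + p.2 * (z 1 : ℂ))) (L z) p := by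
      have e : (fun p : ℂ × ℂ => -Complex.I * (p.1 * (z 0 : ℂ) + p.2 * (z 1 : ℂ))) = L z := by
        ext p; simp [hL]; ring
      rw [e]
      exact (L z).hasFDerivAt
    have h2 := h1.cexp.mul_const (f z)
    rw [smul_smul, mul_comm] at h2
    exact h2

/-- If the Fourier transform vanishes on a real circle, its extension vanishes on the
complexified circle. -/
theorem planeExt_eq_zero_of_sq_add_sq (hγ : 0 < γ) (hf : f ∈ gaussianLp γ 1) {lam : ℝ}
    (hlam : lam ≠ 0) (hv : ∀ ξ : Plane, ‖ξ‖ = |lam| → fourierPlane f ξ = 0) {w t : ℂ}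
    (h : w ^ 2 + t ^ 2 = (lam : ℂ) ^ 2) : planeExt f w t = 0 := by
  -- θ ↦ (λ cos θ, λ sin θ) parametrises the complexified circle, so the identity theorem in θ
  -- carries the zeros over from real θ.
  set φ : ℂ → ℂ := fun θ => planeExt f (lam * Complex.cos θ) (lam * Complex.sin θ) with hφ
  have hd : Differentiable ℂ φ := by
    have h1 := differentiable_planeExt hγ hf
    exact h1.comp_uncurried (Complex.differentiable_cos.const_mul _)
      (Complex.differentiable_sin.const_mul _)
  have hreal : ∀ x : ℝ, φ x = 0 := by
    intro x
    have := hv (!₂[lam * Real.cos x, lam * Real.sin x]) (by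
      rw [Plane.norm_eq, ← Real.sqrt_sq_eq_abs]
      congr 1
      simp only [Matrix.cons_val_zero, Matrix.cons_val_one]
      rw [mul_pow, mul_pow, ← mul_add, Real.cos_sq_add_sin_sq, mul_one])
    rw [fourierPlane_eq_planeExt] at this
    simpa [hφ] using this
  have hzero : φ = 0 := by
    have hA : AnalyticOnNhd ℂ φ Set.univ := fun z _ => hd.analyticAt z
    have hB : AnalyticOnNhd ℂ (0 : ℂ → ℂ) Set.univ := fun z _ => analyticAt_const
    refine hA.eq_of_frequently_eq hB (z₀ := 0) ?_
    have ht : Filter.Tendsto (fun x : ℝ => (x : ℂ)) (nhdsWithin 0 {0}ᶜ) (nhdsWithin 0 {0}ᶜ) := by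
      refine tendsto_nhdsWithin_iff.2 ⟨?_, ?_⟩
      · have : Filter.Tendsto (fun x : ℝ => (x : ℂ)) (nhds 0) (nhds ((0 : ℝ) : ℂ)) :=
          Complex.continuous_ofReal.tendsto 0
        exact (by simpa using this : Filter.Tendsto _ _ _).mono_left nhdsWithin_le_nhds
      · filter_upwards [self_mem_nhdsWithin] with x hx
        simpa using hx
    exact ht.frequently (Filter.Eventually.frequently (Filter.Eventually.of_forall hreal))
  have hl : (lam : ℂ) ≠ 0 := by exact_mod_cast hlam
  obtain ⟨θ, hθ⟩ := Complex.cos_surjective (w / lam)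
  have hs : (Complex.sin θ) ^ 2 = (t / lam) ^ 2 := by
    rw [Complex.sin_sq, hθ, div_pow, div_pow]
    field_simp
    linear_combination -h
  have hw : lam * Complex.cos θ = w := by rw [hθ]; field_simp
  -- Surjectivity of cos fixes sin θ only up to sign; replacing θ by -θ corrects it.
  rcases sq_eq_sq_iff_eq_or_eq_neg.1 hs with h1 | h1
  · have := congrFun hzero θ
    simp only [hφ, Pi.zero_apply, hw, h1] at this
    rwa [mul_div_cancel₀ _ hl] at this
  · have := congrFun hzero (-θ)
    simp only [hφ, Pi.zero_apply, Complex.cos_neg, Complex.sin_neg, hw, h1, neg_neg] at this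
    rwa [mul_div_cancel₀ _ hl] at this

end

/-! ### Plancherel and contour shift on shifted lines -/

/-- The square of the norm in `e^{-γ|z|²}L²`. -/
noncomputable def gaussianNormTwoSq (γ : ℝ) (f : Plane → ℂ) : ℝ≥0∞ :=
  ∫⁻ z : Plane, ‖((Real.exp (γ * ‖z‖ ^ 2) : ℝ) : ℂ) * f z‖ₑ ^ 2

theorem eLpNorm_two_sq_eq_lintegral {α : Type*} [MeasurableSpace α] {μ : Measure α} (g : α → ℂ) :
    eLpNorm g 2 μ ^ 2 = ∫⁻ x, ‖g x‖ₑ ^ 2 ∂μ := by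
  have := eLpNorm_nnreal_pow_eq_lintegral (f := g) (μ := μ) (p := 2) two_ne_zero
  simpa using this

section

variable {γ : ℝ} {f : Plane → ℂ}

theorem gaussianNormTwoSq_ne_top (hf : f ∈ gaussianLp γ 2) : gaussianNormTwoSq γ f ≠ ∞ := by
  unfold gaussianNormTwoSq
  rw [← eLpNorm_two_sq_eq_lintegral]
  exact ENNReal.pow_ne_top (MemLp.eLpNorm_ne_top hf)

/-- Bessel's inequality on a shifted plane. -/
theorem lintegral_enorm_planeExt_sq_le (hγ : 0 < γ) (hf2 : f ∈ gaussianLp γ 2)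
    (hf1 : f ∈ gaussianLp γ 1) (η : ℝ) :
    ∫⁻ ξ : Plane, ‖planeExt f ((ξ 0 : ℝ) + η * Complex.I) (ξ 1 : ℝ)‖ₑ ^ 2 ≤
      ENNReal.ofReal ((2 * Real.pi) ^ 2) *
        (ENNReal.ofReal (Real.exp (η ^ 2 / (4 * γ)) ^ 2) * gaussianNormTwoSq γ f) := by
  set h : Plane → ℂ := fun z => ((Real.exp (η * z 0) : ℝ) : ℂ) * f z with hh
  have hle : ∀ z : Plane,
      Real.exp (η * z 0) ≤ Real.exp (η ^ 2 / (4 * γ)) * Real.exp (γ * ‖z‖ ^ 2) := by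
    intro z
    have hz : z 0 ^ 2 ≤ ‖z‖ ^ 2 := by
      rw [Plane.norm_sq_eq]
      exact le_add_of_nonneg_right (sq_nonneg _)
    refine (exp_mul_le_exp_mul_sq hγ _ _).trans ?_
    have := Real.exp_le_exp.2 (mul_le_mul_of_nonneg_left hz hγ.le)
    gcongr
  have hmeas : AEStronglyMeasurable (fun z : Plane => ((Real.exp (η * z 0) : ℝ) : ℂ)) volume :=
    Continuous.aestronglyMeasurable (by fun_prop)
  have h1 : Integrable h := by
    refine gaussianLp.integrable_mul_of_le hf1 hmeas (fun z => ?_)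
      (K := Real.exp (η ^ 2 / (4 * γ)))
    rw [Complex.norm_real, Real.norm_of_nonneg (by positivity)]
    exact hle z
  have hnorm : ∀ z, ‖h z‖ ≤
      Real.exp (η ^ 2 / (4 * γ)) * ‖((Real.exp (γ * ‖z‖ ^ 2) : ℝ) : ℂ) * f z‖ := by
    intro z
    rw [hh]
    simp only [norm_mul, Complex.norm_real, Real.norm_eq_abs, Real.abs_exp]
    rw [← mul_assoc]
    gcongr
    exact hle z
  have h2 : MemLp h 2 := by
    refine MemLp.of_le_mul hf2 (hmeas.mul (gaussianLp.aestronglyMeasurable hf1))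
      (Filter.Eventually.of_forall hnorm)
  -- The imaginary shift becomes the weight e^{η z₀}; the dilation passes to the normalisation of
  -- `𝓕` and costs the Jacobian (2π)².
  have hF : ∀ ξ : Plane, planeExt f ((ξ 0 : ℝ) + η * Complex.I) (ξ 1 : ℝ) =
      FourierTransform.fourier h ((2 * Real.pi)⁻¹ • ξ) := by
    intro ξ
    rw [Real.fourier_eq', planeExt]
    congr 1; ext z
    rw [hh, smul_eq_mul, ← mul_assoc, Complex.ofReal_exp, ← Complex.exp_add]
    congr 2
    rw [inner_smul_right, Plane.inner_eq]
    push_cast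
    have : (Real.pi : ℂ) ≠ 0 := by exact_mod_cast Real.pi_ne_zero
    field_simp
    linear_combination (-(η : ℂ) * (z 0 : ℂ)) * Complex.I_sq
  have hP := eLpNorm_fourier_eq_of_memLp h1 h2
  have hcov : ∫⁻ ξ : Plane, ‖FourierTransform.fourier h ((2 * Real.pi)⁻¹ • ξ)‖ₑ ^ 2 =
      ENNReal.ofReal ((2 * Real.pi) ^ 2) * ∫⁻ ξ : Plane, ‖FourierTransform.fourier h ξ‖ₑ ^ 2 := by
    have hpi : (2 * Real.pi)⁻¹ ≠ 0 := by positivity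
    have e := Measure.map_addHaar_smul (volume : Measure Plane) hpi
    have e2 := (Homeomorph.smulOfNeZero _ hpi).measurableEmbedding.lintegral_map
      (μ := (volume : Measure Plane)) (fun ξ : Plane => ‖FourierTransform.fourier h ξ‖ₑ ^ 2)
    have e3 : (⇑(Homeomorph.smulOfNeZero _ hpi) : Plane → Plane) =
      fun x => (2 * Real.pi)⁻¹ • x := rfl
    rw [e3] at e2
    rw [← e2, e, lintegral_smul_measure, finrank_euclideanSpace_fin, inv_pow, inv_inv,
      abs_of_nonneg (by positivity), smul_eq_mul]
  simp_rw [hF]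
  rw [hcov, ← eLpNorm_two_sq_eq_lintegral, hP, eLpNorm_two_sq_eq_lintegral]
  gcongr
  unfold gaussianNormTwoSq
  rw [← lintegral_const_mul' _ _ ENNReal.ofReal_ne_top]
  refine lintegral_mono fun z => ?_
  rw [ENNReal.ofReal_pow (by positivity), ← mul_pow]
  gcongr
  rw [← ofReal_norm, ← ofReal_norm, ← ENNReal.ofReal_mul (by positivity)]
  exact ENNReal.ofReal_le_ofReal (hnorm z)

theorem differentiable_planeExt_left (hγ : 0 < γ) (hf : f ∈ gaussianLp γ 1) (t : ℂ) :
    Differentiable ℂ (fun w => planeExt f w t) :=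
  (differentiable_planeExt hγ hf).comp_uncurried differentiable_id (differentiable_const t)

/-- On all but two horizontal lines of frequencies, the contour of integration can be shifted. -/
theorem integral_planeExt_div_shift (hγ : 0 < γ) (hf : f ∈ gaussianLp γ 1) {lam : ℝ}
    (hlam : lam ≠ 0) (hv : ∀ ξ : Plane, ‖ξ‖ = |lam| → fourierPlane f ξ = 0) {r η : ℝ}
    (hr : 0 ≤ r) (hη : 0 ≤ η) {t : ℝ} (ht : t ^ 2 ≠ lam ^ 2) :
    ∫ x : ℝ, Complex.exp (Complex.I * (r * x : ℂ)) *
        (planeExt f x t / ((x : ℂ) ^ 2 + t ^ 2 - lam ^ 2)) =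
      ∫ x : ℝ, Complex.exp (Complex.I * (r * (x + η * Complex.I) : ℂ)) *
        (planeExt f (x + η * Complex.I) t / ((x + η * Complex.I : ℂ) ^ 2 + t ^ 2 - lam ^ 2)) := by
  -- The symbol is w² - a². A complex root a treats |t| < |λ| and |t| > |λ| alike; at t² = λ² the
  -- two zeros would merge.
  obtain ⟨a, ha⟩ := IsAlgClosed.exists_pow_nat_eq ((lam : ℂ) ^ 2 - (t : ℂ) ^ 2) two_pos
  have ha0 : a ≠ 0 := by
    rintro rfl
    refine ht ?_
    have : (lam : ℂ) ^ 2 = (t : ℂ) ^ 2 := by linear_combination -ha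
    exact_mod_cast this.symm
  obtain ⟨G, hG, hGeq⟩ := exists_differentiable_eq_div_sq_sub_sq
    (differentiable_planeExt_left hγ hf (t : ℂ)) ha0
    (planeExt_eq_zero_of_sq_add_sq hγ hf hlam hv (by linear_combination ha))
    (planeExt_eq_zero_of_sq_add_sq hγ hf hlam hv (by linear_combination ha))
  have hline : ∀ y : ℝ, ∀ᵐ x : ℝ, G (x + y * Complex.I) =
      planeExt f (x + y * Complex.I) t / ((x + y * Complex.I : ℂ) ^ 2 + t ^ 2 - lam ^ 2) := by
    intro y
    filter_upwards [Measure.ae_ne volume a.re, Measure.ae_ne volume (-a.re)] with x h1 h2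
    rw [hGeq]
    · congr 1; linear_combination -ha
    · intro h; exact h1 (by simpa using congrArg Complex.re h)
    · intro h; exact h2 (by simpa using congrArg Complex.re h)
  set A := gaussianNormOne γ f with hA
  have hA0 : 0 ≤ A := integral_nonneg fun z => by positivity
  have hX : 0 < 2 * ‖a‖ := by positivity
  have key := integral_eq_integral_add_mul_I_of_decay
    (H := fun w => Complex.exp (Complex.I * (r * w)) * G w) (η := η)
    (C := 2 * (Real.exp (η ^ 2 / (4 * γ)) * A)) (X := 2 * ‖a‖) (by fun_prop) hη hX
    (fun w hw0 hw hwX => by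
      have hre : |w.re| ≤ ‖w‖ := Complex.abs_re_le_norm w
      have hlt : ‖a‖ < ‖w‖ := by linarith [norm_pos_iff.2 ha0]
      have hsq : w.re ^ 2 = |w.re| ^ 2 := (sq_abs _).symm
      have hpos : 0 < |w.re| := hX.trans_le hwX
      -- Since ‖w‖ ≥ 2‖a‖, ‖w‖² - ‖a‖² ≥ ¾‖w‖².
      have hden : w.re ^ 2 / 2 ≤ ‖w ^ 2 - a ^ 2‖ := by
        have h1 := norm_sub_norm_le (w ^ 2) (a ^ 2)
        rw [norm_pow, norm_pow] at h1
        rw [hsq]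
        nlinarith [norm_nonneg a]
      rw [norm_mul, hGeq w (by rintro rfl; exact hlt.ne rfl)
        (by rintro rfl; rw [norm_neg] at hlt; exact hlt.ne rfl), norm_div]
      have he : ‖Complex.exp (Complex.I * (r * w))‖ ≤ 1 := by
        rw [Complex.norm_exp, Real.exp_le_one_iff]
        simp only [Complex.mul_re, Complex.I_re, zero_mul, Complex.I_im, Complex.mul_im,
          Complex.ofReal_re, Complex.ofReal_im, one_mul, add_zero, zero_sub]
        nlinarith [mul_nonneg hr hw0]
      calc _ ≤ 1 * ((Real.exp (η ^ 2 / (4 * γ)) * A) / (w.re ^ 2 / 2)) := by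
            have hw2 : 0 < w.re ^ 2 / 2 := by rw [hsq]; positivity
            gcongr
            refine (norm_planeExt_le hγ hf w t).trans ?_
            gcongr
        _ = _ := by ring)
  have e0 : ∫ x : ℝ, Complex.exp (Complex.I * (r * x : ℂ)) *
        (planeExt f x t / ((x : ℂ) ^ 2 + t ^ 2 - lam ^ 2)) =
      ∫ x : ℝ, Complex.exp (Complex.I * (r * x : ℂ)) * G x := by
    refine integral_congr_ae ?_
    filter_upwards [hline 0] with x hx
    simp only [Complex.ofReal_zero, zero_mul, add_zero] at hx
    rw [hx]
  rw [e0, key]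
  refine integral_congr_ae ?_
  filter_upwards [hline η] with x hx
  rw [hx]

theorem enorm_integral_planeExt_div_le (hγ : 0 < γ) (hf : f ∈ gaussianLp γ 1) {lam : ℝ}
    (hlam : lam ≠ 0) (hv : ∀ ξ : Plane, ‖ξ‖ = |lam| → fourierPlane f ξ = 0) {r η : ℝ}
    (hr : 0 ≤ r) (hη : 0 ≤ η) {t : ℝ} (ht : t ^ 2 ≠ lam ^ 2) :
    ‖∫ x : ℝ, Complex.exp (Complex.I * (r * x : ℂ)) *
        (planeExt f x t / ((x : ℂ) ^ 2 + t ^ 2 - lam ^ 2))‖ₑ ≤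
      ENNReal.ofReal (Real.exp (-(r * η))) * ∫⁻ x : ℝ,
        ‖planeExt f (x + η * Complex.I) t / ((x + η * Complex.I : ℂ) ^ 2 + t ^ 2 - lam ^ 2)‖ₑ := by
  rw [integral_planeExt_div_shift hγ hf hlam hv hr hη ht,
    ← lintegral_const_mul' _ _ ENNReal.ofReal_ne_top]
  refine (enorm_integral_le_lintegral_enorm _).trans (lintegral_mono fun x => ?_)
  rw [enorm_mul]
  gcongr
  rw [← ofReal_norm, Complex.norm_exp]
  refine ENNReal.ofReal_le_ofReal (Real.exp_le_exp.2 (le_of_eq ?_))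
  simp

end

/-! ### Lower bounds for the shifted symbol -/

/-- Lower bound for the symbol on the lines that meet the shifted zero set. -/
theorem symbol_lower_bound_of_sq_le {lam η x t N : ℝ} (hη : 1 ≤ η) (h : lam ^ 2 ≤ t ^ 2)
    (hNsq : N ^ 2 = (x ^ 2 - η ^ 2 + t ^ 2 - lam ^ 2) ^ 2 + 4 * x ^ 2 * η ^ 2) :
    ∃ v : ℝ, (v = t - √(η ^ 2 + lam ^ 2) ∨ v = t + √(η ^ 2 + lam ^ 2)) ∧
      ((|x| ≤ 1 ∧ |v| ≤ 1 ∧ |x| * |v| ≤ N ^ 2) ∨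
        (1 + x ^ 2) * (1 + v ^ 2) ≤ 3 * N ^ 2) := by
  set R := √(η ^ 2 + lam ^ 2) with hR
  have hR2 : R ^ 2 = η ^ 2 + lam ^ 2 := Real.sq_sqrt (by positivity)
  have hR0 : 0 ≤ R := Real.sqrt_nonneg _
  set s := √(t ^ 2 - lam ^ 2) with hs
  have hs0 : 0 ≤ s := Real.sqrt_nonneg _
  have hs2 : s ^ 2 = t ^ 2 - lam ^ 2 := Real.sq_sqrt (by linarith)
  have hRη : η ≤ R := Real.le_sqrt_of_sq_le (le_add_of_nonneg_right (sq_nonneg _))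
  have hst : s ≤ |t| := by
    rw [← abs_of_nonneg hs0]
    exact sq_le_sq.1 (by linarith [sq_nonneg lam])
  -- t² - R² = s² - η² while |t| + R ≥ s + η: the distance to the zero in t is at most that in s.
  have hd : |(|t| - R)| ≤ |s - η| := by
    have e : (|t| - R) * (|t| + R) = (s - η) * (s + η) := by
      have := sq_abs t
      nlinarith
    have e2 : |(|t| - R)| * (|t| + R) = |s - η| * (s + η) := by
      have := congrArg abs e
      rwa [abs_mul, abs_mul, abs_of_nonneg (by positivity : 0 ≤ |t| + R),
        abs_of_nonneg (by positivity : 0 ≤ s + η)] at this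
    have : |(|t| - R)| * (s + η) ≤ |s - η| * (s + η) := by
      rw [← e2]; gcongr
    exact le_of_mul_le_mul_right this (by positivity)
  -- The symbol factors as (x + i(η + s))(x + i(η - s)); only the second factor can be small.
  have hfac : N ^ 2 = (x ^ 2 + (η + s) ^ 2) * (x ^ 2 + (s - η) ^ 2) := by
    rw [hNsq]
    have : x ^ 2 - η ^ 2 + t ^ 2 - lam ^ 2 = x ^ 2 - η ^ 2 + s ^ 2 := by rw [hs2]; ring
    rw [this]; ring
  have key : ∀ v : ℝ, |v| = |(|t| - R)| →
      ((|x| ≤ 1 ∧ |v| ≤ 1 ∧ |x| * |v| ≤ N ^ 2) ∨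
      (1 + x ^ 2) * (1 + v ^ 2) ≤ 3 * N ^ 2) := by
    intro v hv
    have hvs : v ^ 2 ≤ (s - η) ^ 2 := by
      rw [← sq_abs v, ← sq_abs (s - η), hv]; gcongr
    have hss : (s - η) ^ 2 ≤ (η + s) ^ 2 := by
      have e1 : 0 ≤ s * η := by positivity
      have e2 : (η + s) ^ 2 = (s - η) ^ 2 + 4 * (s * η) := by ring
      linarith
    have h1 : 1 ≤ (η + s) ^ 2 := one_le_pow₀ (by linarith)
    have hb1 : x ^ 2 + v ^ 2 ≤ N ^ 2 := by
      rw [hfac]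
      calc x ^ 2 + v ^ 2 ≤ 1 * (x ^ 2 + (s - η) ^ 2) := by linarith
        _ ≤ _ := mul_le_mul_of_nonneg_right (by linarith [sq_nonneg x]) (by positivity)
    have hb2 : (x ^ 2 + v ^ 2) ^ 2 ≤ N ^ 2 := by
      rw [hfac, sq (x ^ 2 + v ^ 2)]
      exact mul_le_mul (by linarith) (by linarith) (by positivity) (by positivity)
    -- Near the zero N² is at least quadratic in the distance; away from it, 1, x² + v² and x²v² are
    -- each at most N², which gives the 3.
    rcases le_total (x ^ 2 + v ^ 2) 1 with hc | hc
    · left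
      refine ⟨?_, ?_, ?_⟩
      · rw [← sq_le_one_iff_abs_le_one]; linarith [sq_nonneg v]
      · rw [← sq_le_one_iff_abs_le_one]; linarith [sq_nonneg x]
      · refine le_trans ?_ hb1
        have e1 := two_mul_le_add_sq |x| |v|
        have e2 : 0 ≤ |x| * |v| := by positivity
        rw [sq_abs, sq_abs] at e1
        linarith
    · right
      have hp : x ^ 2 + v ^ 2 ≤ (x ^ 2 + v ^ 2) ^ 2 := le_self_pow₀ hc two_ne_zero
      have hq : (x ^ 2 + v ^ 2) ^ 2 = x ^ 4 + 2 * (x ^ 2 * v ^ 2) + v ^ 4 := by ring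
      have e : (1 + x ^ 2) * (1 + v ^ 2) = 1 + (x ^ 2 + v ^ 2) + x ^ 2 * v ^ 2 := by ring
      have h4 : 0 ≤ x ^ 4 := by positivity
      have h5 : 0 ≤ v ^ 4 := by positivity
      have h6 : 0 ≤ x ^ 2 * v ^ 2 := by positivity
      linarith
  -- The sign of t selects the nearer zero. Taking v as a translate of t makes later integrals in t
  -- independent of R.
  rcases le_total 0 t with h0 | h0
  · exact ⟨t - R, Or.inl rfl, key _ (by rw [abs_of_nonneg h0])⟩
  · refine ⟨t + R, Or.inr rfl, key _ ?_⟩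
    rw [abs_of_nonpos h0, ← abs_neg]; congr 1; ring

/-- Lower bound for the symbol on the lines that stay away from the shifted zero set. -/
theorem symbol_lower_bound_of_le_sq {lam η x t N : ℝ} (hη : 1 ≤ η) (h : t ^ 2 ≤ lam ^ 2)
    (hNsq : N ^ 2 = (x ^ 2 - η ^ 2 + t ^ 2 - lam ^ 2) ^ 2 + 4 * x ^ 2 * η ^ 2) :
    (1 + x ^ 2) * (1 + t ^ 2) ≤ (4 + lam ^ 2) * (1 + lam ^ 2) * N ^ 2 := by
  set u := lam ^ 2 - t ^ 2 with hu
  have hu0 : 0 ≤ u := by linarith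
  have hul : u ≤ lam ^ 2 := by nlinarith [sq_nonneg t]
  have hη2 : 1 ≤ η ^ 2 := by nlinarith
  have hfac : N ^ 2 = (x ^ 2 + η ^ 2 - u) ^ 2 + 4 * η ^ 2 * u := by rw [hNsq, hu]; ring
  have hx2 : (1 + x ^ 2) ^ 2 ≤ (x ^ 2 + η ^ 2) ^ 2 := by
    exact pow_le_pow_left₀ (by positivity) (by linarith) 2
  have hmain : (1 + x ^ 2) ^ 2 ≤ (4 + lam ^ 2) * N ^ 2 := by
    refine hx2.trans ?_
    have hl2 : 0 ≤ lam ^ 2 * N ^ 2 := by positivity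
    -- If u is at most half of x² + η², the square in `hfac` suffices, with constant 4; otherwise
    -- 4η²u ≥ 4u does, with constant λ².
    rcases le_total (2 * u) (x ^ 2 + η ^ 2) with hc | hc
    · have : (x ^ 2 + η ^ 2) ^ 2 ≤ 4 * (x ^ 2 + η ^ 2 - u) ^ 2 := by
        have := pow_le_pow_left₀ (by positivity)
          (by linarith : x ^ 2 + η ^ 2 ≤ 2 * (x ^ 2 + η ^ 2 - u)) 2
        linarith
      have : 0 ≤ η ^ 2 * u := by positivity
      rw [add_mul]
      linarith
    · have h1 : (x ^ 2 + η ^ 2) ^ 2 ≤ 4 * u ^ 2 := by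
        have := pow_le_pow_left₀ (by positivity) hc 2
        linarith
      have h2 : 4 * u ≤ N ^ 2 := by
        rw [hfac]
        linarith [sq_nonneg (x ^ 2 + η ^ 2 - u), mul_nonneg hu0 (sub_nonneg.2 hη2)]
      have h3 : 4 * u ^ 2 ≤ lam ^ 2 * N ^ 2 := by
        calc 4 * u ^ 2 = u * (4 * u) := by ring
          _ ≤ lam ^ 2 * N ^ 2 := by gcongr
      rw [add_mul]
      linarith [sq_nonneg N]
  have ht : 1 + t ^ 2 ≤ 1 + lam ^ 2 := by linarith
  calc (1 + x ^ 2) * (1 + t ^ 2) ≤ (1 + x ^ 2) ^ 2 * (1 + lam ^ 2) := by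
        gcongr
        nlinarith [sq_nonneg x]
    _ ≤ (4 + lam ^ 2) * N ^ 2 * (1 + lam ^ 2) :=
        mul_le_mul_of_nonneg_right hmain (by positivity)
    _ = _ := by ring

/-! ### Integrable majorants of the quotient -/

/-- The function `|x|^{-1/2}` cut off to `0 < |x| ≤ 1`. -/
noncomputable def cutoffInvSqrt (x : ℝ) : ℝ≥0∞ :=
  (Set.Ioc (0 : ℝ) 1).indicator (fun y => ENNReal.ofReal (√y)⁻¹) |x|

/-- The function `(1 + x²)⁻¹`. -/
noncomputable def invOneAddSq (x : ℝ) : ℝ≥0∞ := ENNReal.ofReal (1 + x ^ 2)⁻¹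

theorem measurable_cutoffInvSqrt : Measurable cutoffInvSqrt := by
  have : Measurable ((Set.Ioc (0 : ℝ) 1).indicator (fun y => ENNReal.ofReal (√y)⁻¹)) :=
    Measurable.indicator (by fun_prop) measurableSet_Ioc
  exact this.comp (by fun_prop : Measurable fun x : ℝ => |x|)

theorem measurable_invOneAddSq : Measurable invOneAddSq := by
  unfold invOneAddSq
  fun_prop

theorem lintegral_invOneAddSq_ne_top : ∫⁻ x, invOneAddSq x ≠ ∞ := by
  have := integrable_inv_one_add_sq.lintegral_lt_top
  exact this.ne

theorem lintegral_cutoffInvSqrt_ne_top : ∫⁻ x, cutoffInvSqrt x ≠ ∞ := by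
  set k : ℝ → ℝ≥0∞ := (Set.Ioc (0 : ℝ) 1).indicator (fun y => ENNReal.ofReal (√y)⁻¹) with hk
  have hkm : Measurable k := Measurable.indicator (by fun_prop) measurableSet_Ioc
  have hfin : ∫⁻ x, k x ≠ ∞ := by
    have h := (intervalIntegral.intervalIntegrable_rpow' (a := 0) (b := 1)
      (by norm_num : (-1 : ℝ) < -(1 / 2))).1
    have h2 := h.lintegral_lt_top
    rw [hk, lintegral_indicator measurableSet_Ioc]
    refine ne_of_eq_of_ne ?_ h2.ne
    refine setLIntegral_congr_fun measurableSet_Ioc fun y hy => ?_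
    rw [Real.rpow_neg hy.1.le, ← Real.sqrt_eq_rpow]
  have hle : ∀ x, cutoffInvSqrt x ≤ k x + k (-x) := by
    intro x
    unfold cutoffInvSqrt
    rcases abs_choice x with h | h
    · rw [h]; exact le_self_add
    · rw [h]; exact le_add_self
  refine ne_top_of_le_ne_top ?_ (lintegral_mono hle)
  rw [lintegral_add_left hkm, lintegral_neg_eq_self k]
  exact ENNReal.add_ne_top.2 ⟨hfin, hfin⟩

theorem cutoffInvSqrt_of_abs_le {x : ℝ} (hx : x ≠ 0) (hx1 : |x| ≤ 1) :
    cutoffInvSqrt x = ENNReal.ofReal (√|x|)⁻¹ := by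
  unfold cutoffInvSqrt
  rw [Set.indicator_of_mem (show |x| ∈ Set.Ioc (0 : ℝ) 1 from ⟨abs_pos.2 hx, hx1⟩)]

/-- For use near a zero of the symbol: there |q|⁻² is not integrable in the plane, but |q|⁻¹ is, and
it splits into two one-dimensional singularities. -/
theorem enorm_div_le_cutoffInvSqrt {P q : ℂ} {x v E A : ℝ} (hx : x ≠ 0) (hv : v ≠ 0)
    (hx1 : |x| ≤ 1) (hv1 : |v| ≤ 1) (h : |x| * |v| ≤ ‖q‖ ^ 2) (hE : 0 ≤ E) (hA : 0 ≤ A)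
    (hP : ‖P‖ ≤ E * A) :
    ‖P / q‖ₑ ≤ ENNReal.ofReal E * (ENNReal.ofReal A * (cutoffInvSqrt x * cutoffInvSqrt v)) := by
  rw [cutoffInvSqrt_of_abs_le hx hx1, cutoffInvSqrt_of_abs_le hv hv1,
    ← ENNReal.ofReal_mul (by positivity), ← ENNReal.ofReal_mul hA, ← ENNReal.ofReal_mul hE,
    ← ofReal_norm]
  refine ENNReal.ofReal_le_ofReal ?_
  have hxp := abs_pos.2 hx
  have hvp := abs_pos.2 hv
  have hq : √|x| * √|v| ≤ ‖q‖ := by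
    rw [← Real.sqrt_mul (abs_nonneg _)]
    exact Real.sqrt_le_iff.2 ⟨norm_nonneg _, h⟩
  rw [norm_div, ← mul_inv, ← mul_assoc, div_eq_mul_inv]
  gcongr

/-- Arithmetic-geometric mean inequality for ‖P‖/E and 1/‖q‖. Normalising by E makes the square of P
cancel the factor E² in Bessel's inequality. -/
theorem enorm_div_le_invOneAddSq {P q : ℂ} {x v E c : ℝ} (hE : 0 < E) (hc : 0 ≤ c)
    (h : (1 + x ^ 2) * (1 + v ^ 2) ≤ c * ‖q‖ ^ 2) :
    ‖P / q‖ₑ ≤ ENNReal.ofReal E * (ENNReal.ofReal ((E ^ 2)⁻¹) * ‖P‖ₑ ^ 2 +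
      ENNReal.ofReal c * (invOneAddSq x * invOneAddSq v)) := by
  unfold invOneAddSq
  rw [← ofReal_norm P, ← ENNReal.ofReal_pow (norm_nonneg _), ← ENNReal.ofReal_mul (by positivity),
    ← ENNReal.ofReal_mul (by positivity), ← ENNReal.ofReal_mul hc,
    ← ENNReal.ofReal_add (by positivity) (by positivity), ← ENNReal.ofReal_mul hE.le,
    ← ofReal_norm]
  refine ENNReal.ofReal_le_ofReal ?_
  have hq2 : 0 < ‖q‖ ^ 2 := by
    by_contra hneg
    have h0 : ‖q‖ ^ 2 = 0 := le_antisymm (not_lt.1 hneg) (sq_nonneg _)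
    rw [h0, mul_zero] at h
    have : 0 < (1 + x ^ 2) * (1 + v ^ 2) := by positivity
    linarith
  have h1 : (‖q‖ ^ 2)⁻¹ ≤ c * ((1 + x ^ 2)⁻¹ * (1 + v ^ 2)⁻¹) := by
    rw [← mul_inv, ← div_eq_mul_inv, inv_le_iff_one_le_mul₀ hq2, div_mul_eq_mul_div,
      le_div_iff₀ (by positivity)]
    linarith
  have h2 : ‖P‖ / E * ‖q‖⁻¹ ≤ (E ^ 2)⁻¹ * ‖P‖ ^ 2 + (‖q‖ ^ 2)⁻¹ := by
    have e := two_mul_le_add_sq (‖P‖ / E) ‖q‖⁻¹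
    have e0 : 0 ≤ ‖P‖ / E * ‖q‖⁻¹ := by positivity
    have e1 : (‖P‖ / E) ^ 2 = (E ^ 2)⁻¹ * ‖P‖ ^ 2 := by rw [div_pow]; ring
    rw [e1, inv_pow] at e
    linarith
  calc ‖P / q‖ = E * (‖P‖ / E * ‖q‖⁻¹) := by rw [norm_div]; field_simp
    _ ≤ _ := by
      gcongr
      exact h2.trans (by gcongr)

theorem norm_symbol_sq (lam η x t : ℝ) :
    ‖((x : ℂ) + η * Complex.I) ^ 2 + (t : ℂ) ^ 2 - (lam : ℂ) ^ 2‖ ^ 2 =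
      (x ^ 2 - η ^ 2 + t ^ 2 - lam ^ 2) ^ 2 + 4 * x ^ 2 * η ^ 2 := by
  have : ((x : ℂ) + η * Complex.I) ^ 2 + (t : ℂ) ^ 2 - (lam : ℂ) ^ 2 =
      ((x ^ 2 - η ^ 2 + t ^ 2 - lam ^ 2 : ℝ) : ℂ) + ((2 * x * η : ℝ) : ℂ) * Complex.I := by
    push_cast
    linear_combination (η : ℂ) ^ 2 * Complex.I_sq
  rw [this, Complex.sq_norm, Complex.normSq_add_mul_I]
  ring

/-! ### Integration over the shifted plane -/

/-- The measure-preserving identification of `ℝ × ℝ` with the plane. -/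
def prodEquivPlane : ℝ × ℝ ≃ᵐ Plane :=
  MeasurableEquiv.finTwoArrow.symm.trans (MeasurableEquiv.toLp 2 (Fin 2 → ℝ))

theorem measurePreserving_prodEquivPlane : MeasurePreserving prodEquivPlane :=
  (PiLp.volume_preserving_toLp (Fin 2)).comp (volume_preserving_finTwoArrow ℝ).symm

theorem lintegral_plane_eq {g : Plane → ℝ≥0∞} (hg : Measurable g) :
    ∫⁻ ξ, g ξ = ∫⁻ t : ℝ, ∫⁻ x : ℝ, g !₂[x, t] := by
  rw [← measurePreserving_prodEquivPlane.lintegral_comp hg, Measure.volume_eq_prod,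
    lintegral_prod_symm (fun p => g (prodEquivPlane p)) (hg.comp prodEquivPlane.measurable).aemeasurable]
  rfl

theorem integral_plane_eq {g : Plane → ℂ} (hg : Integrable g) :
    ∫ ξ, g ξ = ∫ t : ℝ, ∫ x : ℝ, g !₂[x, t] := by
  have h := (measurePreserving_prodEquivPlane.integrable_comp_emb
    prodEquivPlane.measurableEmbedding).2 hg
  rw [← measurePreserving_prodEquivPlane.integral_comp prodEquivPlane.measurableEmbedding]
  rw [Measure.volume_eq_prod] at h ⊢
  exact integral_prod_symm _ h

theorem lintegral_lintegral_mul_translate {k : ℝ → ℝ≥0∞} (hk : Measurable k) (s : ℝ) :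
    ∫⁻ t : ℝ, ∫⁻ x : ℝ, k x * k (t + s) = (∫⁻ x, k x) * ∫⁻ x, k x := by
  have : ∀ t : ℝ, ∫⁻ x : ℝ, k x * k (t + s) = (∫⁻ x, k x) * k (t + s) := fun t =>
    lintegral_mul_const _ hk
  simp_rw [this]
  have hks : Measurable fun t : ℝ => k (t + s) := hk.comp (by fun_prop)
  rw [lintegral_const_mul _ hks, lintegral_add_right_eq_self k s]

section

variable {γ : ℝ} {f : Plane → ℂ}

/-- The constant in the bound for `∫∫ |f̂(ξ + iη)| / |(ξ + iη)² - lam²| dξ`. -/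
noncomputable def shiftConst (lam A : ℝ) (B : ℝ≥0∞) : ℝ≥0∞ :=
  2 * (ENNReal.ofReal A * ((∫⁻ x, cutoffInvSqrt x) * ∫⁻ x, cutoffInvSqrt x)) +
  2 * (ENNReal.ofReal 3 * ((∫⁻ x, invOneAddSq x) * ∫⁻ x, invOneAddSq x)) +
  ENNReal.ofReal ((4 + lam ^ 2) * (1 + lam ^ 2)) *
    ((∫⁻ x, invOneAddSq x) * ∫⁻ x, invOneAddSq x) +
  ENNReal.ofReal ((2 * Real.pi) ^ 2) * B

theorem shiftConst_ne_top (lam A : ℝ) {B : ℝ≥0∞} (hB : B ≠ ∞) : shiftConst lam A B ≠ ∞ := by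
  have h1 := lintegral_invOneAddSq_ne_top
  have h2 := lintegral_cutoffInvSqrt_ne_top
  unfold shiftConst
  finiteness

theorem continuous_planeExt_shift (hγ : 0 < γ) (hf1 : f ∈ gaussianLp γ 1) (η : ℝ) :
    Continuous fun p : ℝ × ℝ => planeExt f (p.1 + η * Complex.I) p.2 :=
  (differentiable_planeExt hγ hf1).continuous.comp
    (f := fun p : ℝ × ℝ => (((p.1 : ℂ) + η * Complex.I, (p.2 : ℂ)) : ℂ × ℂ)) (by fun_prop)

/-- Apart from E the bound does not depend on η: the position R of the zeros disappears by
translation invariance in t. -/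
theorem lintegral_planeExt_div_le (hγ : 0 < γ) (hf2 : f ∈ gaussianLp γ 2)
    (hf1 : f ∈ gaussianLp γ 1) (lam : ℝ) {η : ℝ} (hη : 1 ≤ η) :
    ∫⁻ t : ℝ, ∫⁻ x : ℝ,
        ‖planeExt f (x + η * Complex.I) t / ((x + η * Complex.I : ℂ) ^ 2 + t ^ 2 - lam ^ 2)‖ₑ ≤
      ENNReal.ofReal (Real.exp (η ^ 2 / (4 * γ))) *
        shiftConst lam (gaussianNormOne γ f) (gaussianNormTwoSq γ f) := by
  set E := Real.exp (η ^ 2 / (4 * γ)) with hE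
  have hE0 : 0 < E := Real.exp_pos _
  set A := gaussianNormOne γ f with hA
  have hA0 : 0 ≤ A := integral_nonneg fun z => by positivity
  set R := √(η ^ 2 + lam ^ 2) with hR
  set c := (4 + lam ^ 2) * (1 + lam ^ 2) with hc
  have hc0 : 0 ≤ c := by positivity
  -- `T1` and `T2`, with s = ∓R, serve the region near a zero and the rest of t² ≥ λ²; `T3` serves
  -- t² ≤ λ²; `T4` is the Plancherel term.
  set T1 : ℝ → ℝ → ℝ → ℝ≥0∞ := fun s t x =>
    ENNReal.ofReal A * (cutoffInvSqrt x * cutoffInvSqrt (t + s)) with hT1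
  set T2 : ℝ → ℝ → ℝ → ℝ≥0∞ := fun s t x =>
    ENNReal.ofReal 3 * (invOneAddSq x * invOneAddSq (t + s)) with hT2
  set T3 : ℝ → ℝ → ℝ≥0∞ := fun t x =>
    ENNReal.ofReal c * (invOneAddSq x * invOneAddSq (t + 0)) with hT3
  set T4 : ℝ → ℝ → ℝ≥0∞ := fun t x =>
    ENNReal.ofReal ((E ^ 2)⁻¹) * ‖planeExt f (x + η * Complex.I) t‖ₑ ^ 2 with hT4
  have hm1 : ∀ s, Measurable (Function.uncurry (T1 s)) := fun s => by
    have h1 := measurable_cutoffInvSqrt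
    exact Measurable.const_mul ((h1.comp measurable_snd).mul
      (h1.comp (measurable_fst.add_const s))) _
  have hm2 : ∀ s, Measurable (Function.uncurry (T2 s)) := fun s => by
    have h1 := measurable_invOneAddSq
    exact Measurable.const_mul ((h1.comp measurable_snd).mul
      (h1.comp (measurable_fst.add_const s))) _
  have hm3 : Measurable (Function.uncurry T3) := by
    have h1 := measurable_invOneAddSq
    exact Measurable.const_mul ((h1.comp measurable_snd).mul
      (h1.comp (measurable_fst.add_const 0))) _
  have hadd : ∀ {u v : ℝ → ℝ → ℝ≥0∞}, Measurable (Function.uncurry u) →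
      ∫⁻ t : ℝ, ∫⁻ x : ℝ, (u t x + v t x) =
        (∫⁻ t : ℝ, ∫⁻ x : ℝ, u t x) + ∫⁻ t : ℝ, ∫⁻ x : ℝ, v t x := by
    intro u v hu
    have : ∀ t : ℝ, ∫⁻ x : ℝ, (u t x + v t x) = (∫⁻ x : ℝ, u t x) + ∫⁻ x : ℝ, v t x := fun t =>
      lintegral_add_left (hu.comp measurable_prodMk_left) _
    simp_rw [this]
    exact lintegral_add_left hu.lintegral_prod_right' _
  have hcm : ∀ {u : ℝ → ℝ → ℝ≥0∞} (a : ℝ), ∫⁻ t : ℝ, ∫⁻ x : ℝ, ENNReal.ofReal a * u t x =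
      ENNReal.ofReal a * ∫⁻ t : ℝ, ∫⁻ x : ℝ, u t x := by
    intro u a
    simp_rw [lintegral_const_mul' _ _ ENNReal.ofReal_ne_top]
  -- `cutoffInvSqrt` is 0 at 0, so three null lines are left out.
  have hpt : ∀ t x : ℝ, t - R ≠ 0 → t + R ≠ 0 → x ≠ 0 →
      ‖planeExt f (x + η * Complex.I) t / ((x + η * Complex.I : ℂ) ^ 2 + t ^ 2 - lam ^ 2)‖ₑ ≤
        ENNReal.ofReal E * (T1 (-R) t x + (T1 R t x + (T2 (-R) t x + (T2 R t x +
          (T3 t x + T4 t x))))) := by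
    intro t x htR htR' hx
    have hP : ‖planeExt f (x + η * Complex.I) t‖ ≤ E * A := by
      simpa using norm_planeExt_le hγ hf1 (x + η * Complex.I) t
    have hN := norm_symbol_sq lam η x t
    rcases le_total (lam ^ 2) (t ^ 2) with h | h
    · obtain ⟨v, hv, hcase⟩ := symbol_lower_bound_of_sq_le hη h hN
      have hv0 : v ≠ 0 := by rcases hv with rfl | rfl <;> assumption
      rcases hcase with ⟨h1, h2, h3⟩ | h1
      · refine (enorm_div_le_cutoffInvSqrt hx hv0 h1 h2 h3 hE0.le hA0 hP).trans ?_
        gcongr ENNReal.ofReal E * ?_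
        rcases hv with rfl | rfl
        · exact le_self_add
        · exact le_add_left le_self_add
      · refine (enorm_div_le_invOneAddSq hE0 (by norm_num) h1).trans ?_
        rw [add_comm]
        gcongr ENNReal.ofReal E * ?_
        rcases hv with rfl | rfl
        · refine le_add_left (le_add_left ?_)
          exact add_le_add le_rfl (le_add_left le_add_self)
        · refine le_add_left (le_add_left (le_add_left ?_))
          exact add_le_add le_rfl le_add_self
    · have h1 := symbol_lower_bound_of_le_sq hη h hN
      refine (enorm_div_le_invOneAddSq hE0 hc0 h1).trans ?_
      rw [add_comm]
      gcongr ENNReal.ofReal E * ?_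
      refine le_add_left (le_add_left (le_add_left (le_add_left ?_)))
      rw [hT3, hT4]
      simp only [add_zero]
      exact le_rfl
  have hmono : ∫⁻ t : ℝ, ∫⁻ x : ℝ,
        ‖planeExt f (x + η * Complex.I) t / ((x + η * Complex.I : ℂ) ^ 2 + t ^ 2 - lam ^ 2)‖ₑ ≤
      ∫⁻ t : ℝ, ∫⁻ x : ℝ, ENNReal.ofReal E * (T1 (-R) t x + (T1 R t x + (T2 (-R) t x +
        (T2 R t x + (T3 t x + T4 t x))))) := by
    refine lintegral_mono_ae ?_
    filter_upwards [Measure.ae_ne volume R, Measure.ae_ne volume (-R)] with t h1 h2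
    refine lintegral_mono_ae ?_
    filter_upwards [Measure.ae_ne volume 0] with x hx
    exact hpt t x (sub_ne_zero.2 h1) (fun h => h2 (eq_neg_of_add_eq_zero_left h)) hx
  refine hmono.trans ?_
  have hL2 : ∫⁻ t : ℝ, ∫⁻ x : ℝ, T4 t x ≤
      ENNReal.ofReal ((2 * Real.pi) ^ 2) * gaussianNormTwoSq γ f := by
    have hcont := (continuous_planeExt_shift hγ hf1 η).enorm
    have hg : Measurable fun ξ : Plane =>
        ‖planeExt f ((ξ 0 : ℝ) + η * Complex.I) (ξ 1 : ℝ)‖ₑ ^ 2 :=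
      (hcont.comp (f := fun ξ : Plane => (ξ 0, ξ 1)) (by fun_prop)).measurable.pow_const 2
    have e := lintegral_enorm_planeExt_sq_le hγ hf2 hf1 η
    rw [lintegral_plane_eq hg] at e
    rw [hT4, hcm]
    simp only [Matrix.cons_val_zero, Matrix.cons_val_one] at e
    calc _ ≤ ENNReal.ofReal ((E ^ 2)⁻¹) * (ENNReal.ofReal ((2 * Real.pi) ^ 2) *
          (ENNReal.ofReal (E ^ 2) * gaussianNormTwoSq γ f)) := by gcongr
      _ = (ENNReal.ofReal ((E ^ 2)⁻¹) * ENNReal.ofReal (E ^ 2)) *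
          (ENNReal.ofReal ((2 * Real.pi) ^ 2) * gaussianNormTwoSq γ f) := by ring
      _ = _ := by
        rw [← ENNReal.ofReal_mul (by positivity), inv_mul_cancel₀ (by positivity),
          ENNReal.ofReal_one, one_mul]
  rw [hcm, hadd (hm1 _), hadd (hm1 _), hadd (hm2 _), hadd (hm2 _), hadd hm3]
  gcongr
  rw [hT1, hT2, hT3]
  simp only [hcm, lintegral_lintegral_mul_translate measurable_cutoffInvSqrt,
    lintegral_lintegral_mul_translate measurable_invOneAddSq]
  unfold shiftConst
  calc _ ≤ _ := add_le_add le_rfl (add_le_add le_rfl (add_le_add le_rfl (add_le_add le_rfl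
        (add_le_add le_rfl hL2))))
    _ = _ := by ring

end

/-! ### Integrability of the quotient -/

section

variable {γ : ℝ} {f : Plane → ℂ}

theorem continuous_fourierPlane (hγ : 0 < γ) (hf1 : f ∈ gaussianLp γ 1) :
    Continuous (fourierPlane f) := by
  have h : fourierPlane f = fun ξ : Plane => planeExt f (ξ 0 : ℝ) (ξ 1 : ℝ) :=
    funext (fourierPlane_eq_planeExt f)
  rw [h]
  exact (differentiable_planeExt hγ hf1).continuous.comp
    (f := fun ξ : Plane => (((ξ 0 : ℝ) : ℂ), ((ξ 1 : ℝ) : ℂ))) (by fun_prop)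

theorem memLp_two_fourierPlane (hγ : 0 < γ) (hf2 : f ∈ gaussianLp γ 2)
    (hf1 : f ∈ gaussianLp γ 1) : MemLp (fourierPlane f) 2 := by
  refine ⟨(continuous_fourierPlane hγ hf1).aestronglyMeasurable, ?_⟩
  have h := lintegral_enorm_planeExt_sq_le hγ hf2 hf1 0
  simp only [Complex.ofReal_zero, zero_mul, add_zero, ← fourierPlane_eq_planeExt] at h
  rw [← eLpNorm_two_sq_eq_lintegral] at h
  have hB := gaussianNormTwoSq_ne_top hf2
  have : eLpNorm (fourierPlane f) 2 volume ^ 2 < ∞ := h.trans_lt (by finiteness)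
  by_contra hcon
  rw [not_lt, top_le_iff] at hcon
  simp [hcon] at this

/-- The Fourier transform is Lipschitz, with the first moment as constant. -/
theorem norm_fourierPlane_sub_le (hγ : 0 < γ) (hf1 : f ∈ gaussianLp γ 1) (ξ ξ' : Plane) :
    ‖fourierPlane f ξ - fourierPlane f ξ'‖ ≤ ‖ξ - ξ'‖ * ∫ z, ‖z‖ * ‖f z‖ := by
  have hint : ∀ ξ : Plane, Integrable fun z : Plane =>
      Complex.exp (-Complex.I * ((inner ℝ ξ z : ℝ) : ℂ)) * f z := by
    intro ξ
    refine (integrable_planeExt hγ hf1 (ξ 0 : ℝ) (ξ 1 : ℝ)).congr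
      (Filter.Eventually.of_forall fun z => ?_)
    simp only [Plane.inner_eq]
    push_cast
    rfl
  have hmom : Integrable fun z : Plane => ‖z‖ * ‖f z‖ := by
    have := gaussianLp.integrable_mul_of_le hf1 (m := fun z => ((‖z‖ : ℝ) : ℂ))
      (K := Real.exp (1 ^ 2 / (4 * γ))) (Continuous.aestronglyMeasurable (by fun_prop))
      (fun z => by
        rw [Complex.norm_real, norm_norm]
        refine le_trans ?_ (exp_mul_le_exp_mul_sq hγ 1 ‖z‖)
        rw [one_mul]
        linarith [Real.add_one_le_exp ‖z‖])
    refine this.norm.congr (Filter.Eventually.of_forall fun z => ?_)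
    simp
  unfold fourierPlane
  rw [← integral_sub (hint ξ) (hint ξ'), ← integral_const_mul]
  refine norm_integral_le_of_norm_le (hmom.const_mul _) (Filter.Eventually.of_forall fun z => ?_)
  rw [← sub_mul, norm_mul, ← mul_assoc]
  gcongr
  have e : Complex.exp (-Complex.I * ((inner ℝ ξ z : ℝ) : ℂ)) -
      Complex.exp (-Complex.I * ((inner ℝ ξ' z : ℝ) : ℂ)) =
      Complex.exp (((-inner ℝ ξ' z : ℝ) : ℂ) * Complex.I) *
        (Complex.exp (Complex.I * ((-inner ℝ (ξ - ξ') z : ℝ) : ℂ)) - 1) := by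
    rw [mul_sub, ← Complex.exp_add, inner_sub_left]
    push_cast
    rw [mul_one]
    congr 2 <;> ring
  rw [e, norm_mul, Complex.norm_exp_ofReal_mul_I, one_mul]
  refine Real.norm_exp_I_mul_ofReal_sub_one_le.trans ?_
  rw [norm_neg]
  exact norm_inner_le_norm _ _

theorem Plane.exists_norm_eq_norm_sub_eq (ξ : Plane) (lam : ℝ) :
    ∃ ξ' : Plane, ‖ξ'‖ = |lam| ∧ ‖ξ - ξ'‖ = |(‖ξ‖ - |lam|)| := by
  by_cases h : ξ = 0
  · refine ⟨!₂[lam, 0], ?_, ?_⟩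
    · rw [Plane.norm_eq]; simp [Real.sqrt_sq_eq_abs]
    · rw [h, zero_sub, norm_neg, Plane.norm_eq]; simp [Real.sqrt_sq_eq_abs]
  · have hn : ‖ξ‖ ≠ 0 := norm_ne_zero_iff.2 h
    refine ⟨(|lam| / ‖ξ‖) • ξ, ?_, ?_⟩
    · rw [norm_smul, norm_div, norm_norm, Real.norm_eq_abs, abs_abs, div_mul_cancel₀ _ hn]
    · have : ξ - (|lam| / ‖ξ‖) • ξ = (1 - |lam| / ‖ξ‖) • ξ := by rw [sub_smul, one_smul]
      rw [this, norm_smul, Real.norm_eq_abs, ← abs_of_nonneg (norm_nonneg ξ), ← abs_mul,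
        abs_of_nonneg (norm_nonneg ξ), sub_mul, one_mul, div_mul_cancel₀ _ hn]

/-- The transform vanishes at the nearest point of the circle, so its Lipschitz bound cancels the
factor ‖ξ‖ - |λ|; the other factor is at least |λ|. -/
theorem norm_fourierPlane_div_le (hγ : 0 < γ) (hf1 : f ∈ gaussianLp γ 1) {lam : ℝ}
    (hlam : lam ≠ 0) (hv : ∀ ξ : Plane, ‖ξ‖ = |lam| → fourierPlane f ξ = 0) (ξ : Plane) :
    ‖fourierPlane f ξ / ((‖ξ‖ ^ 2 - lam ^ 2 : ℝ) : ℂ)‖ ≤ (∫ z, ‖z‖ * ‖f z‖) / |lam| := by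
  have hL : 0 ≤ ∫ z, ‖z‖ * ‖f z‖ := integral_nonneg fun z => by positivity
  have hl : 0 < |lam| := abs_pos.2 hlam
  have hlip := norm_fourierPlane_sub_le hγ hf1
  generalize (∫ z, ‖z‖ * ‖f z‖) = L at *
  obtain ⟨ξ', h1, h2⟩ := Plane.exists_norm_eq_norm_sub_eq ξ lam
  have h3 := hlip ξ ξ'
  rw [hv ξ' h1, sub_zero, h2] at h3
  rw [norm_div, Complex.norm_real, Real.norm_eq_abs]
  have e : |‖ξ‖ ^ 2 - lam ^ 2| = |(‖ξ‖ - |lam|)| * (‖ξ‖ + |lam|) := by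
    have e1 : ‖ξ‖ ^ 2 - lam ^ 2 = (‖ξ‖ - |lam|) * (‖ξ‖ + |lam|) := by
      rw [← sq_abs lam]; ring
    have e2 : 0 ≤ ‖ξ‖ + |lam| := add_nonneg (norm_nonneg _) hl.le
    rw [e1, abs_mul]
    exact congrArg _ (abs_of_nonneg e2)
  refine div_le_of_le_mul₀ (abs_nonneg _) (by positivity) (h3.trans ?_)
  rw [e]
  calc |(‖ξ‖ - |lam|)| * L
      = L / |lam| * (|(‖ξ‖ - |lam|)| * |lam|) := by field_simp
    _ ≤ _ := by
      gcongr
      linarith [norm_nonneg ξ]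

theorem integrable_fourierPlane_div (hγ : 0 < γ) (hf2 : f ∈ gaussianLp γ 2)
    (hf1 : f ∈ gaussianLp γ 1) {lam : ℝ}
    (hlam : lam ≠ 0) (hv : ∀ ξ : Plane, ‖ξ‖ = |lam| → fourierPlane f ξ = 0) :
    Integrable (fun ξ : Plane => fourierPlane f ξ / ((‖ξ‖ ^ 2 - lam ^ 2 : ℝ) : ℂ)) := by
  set L := (∫ z, ‖z‖ * ‖f z‖) / |lam| with hL
  have hL0 : 0 ≤ L := div_nonneg (integral_nonneg fun z => by positivity) (abs_nonneg _)
  have hdec : Integrable fun ξ : Plane => ((1 + ‖ξ‖ ^ 2) ^ 2)⁻¹ := by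
    have := integrable_rpow_neg_one_add_norm_sq (E := Plane) (μ := volume) (r := 4)
      (by rw [finrank_euclideanSpace_fin]; norm_num)
    refine this.congr (Filter.Eventually.of_forall fun ξ => ?_)
    beta_reduce
    rw [show (-4 / 2 : ℝ) = -((2 : ℕ) : ℝ) by norm_num, Real.rpow_neg (by positivity),
      Real.rpow_natCast]
  have hsq : Integrable fun ξ : Plane => ‖fourierPlane f ξ‖ ^ 2 :=
    (memLp_two_fourierPlane hγ hf2 hf1).integrable_norm_pow two_ne_zero
  -- For s = 1 + ‖ξ‖² ≥ 2 + 2λ² the symbol is at least s/4, whence 16 = 4²; for smaller s the other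
  -- constant dominates the uniform bound L.
  refine (hsq.add (hdec.const_mul (16 + L * (2 + 2 * lam ^ 2) ^ 2))).mono' ?_
    (Filter.Eventually.of_forall fun ξ => ?_)
  · have h1 := (continuous_fourierPlane hγ hf1).measurable
    have h2 : Measurable fun ξ : Plane => ((‖ξ‖ ^ 2 - lam ^ 2 : ℝ) : ℂ) :=
      Continuous.measurable (by fun_prop)
    exact (h1.div h2).aestronglyMeasurable
  · simp only [Pi.add_apply]
    set s := 1 + ‖ξ‖ ^ 2 with hs
    have hs1 : 1 ≤ s := le_add_of_nonneg_right (sq_nonneg _)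
    have hs0 : 0 < s := by linarith
    rw [← div_eq_mul_inv, add_div]
    rcases le_total s (2 + 2 * lam ^ 2) with h | h
    · have h1 := norm_fourierPlane_div_le hγ hf1 hlam hv ξ
      have h2 : L ≤ L * (2 + 2 * lam ^ 2) ^ 2 / s ^ 2 := by
        rw [mul_div_assoc]
        refine le_mul_of_one_le_right hL0 ?_
        rw [one_le_div (by positivity)]
        gcongr
      have h3 : 0 ≤ 16 / s ^ 2 := by positivity
      have h4 := sq_nonneg ‖fourierPlane f ξ‖
      linarith
    · have hden : s / 4 ≤ ‖ξ‖ ^ 2 - lam ^ 2 := by linarith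
      rw [norm_div, Complex.norm_real, Real.norm_of_nonneg (by linarith)]
      have h1 : ‖fourierPlane f ξ‖ / (‖ξ‖ ^ 2 - lam ^ 2) ≤ ‖fourierPlane f ξ‖ * (4 / s) := by
        calc _ ≤ ‖fourierPlane f ξ‖ / (s / 4) := by gcongr
          _ = _ := by field_simp
      have h2 := two_mul_le_add_sq ‖fourierPlane f ξ‖ (4 / s)
      have h3 : (4 / s) ^ 2 = 16 / s ^ 2 := by rw [div_pow]; norm_num
      have h4 : 0 ≤ L * (2 + 2 * lam ^ 2) ^ 2 / s ^ 2 := by positivity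
      have h5 : 0 ≤ ‖fourierPlane f ξ‖ * (4 / s) := by positivity
      rw [h3] at h2
      linarith

/-! ### Decay of the inverse transform -/

theorem norm_fourierInvPlane_le {F : Plane → ℂ} (z : Plane) :
    ‖fourierInvPlane F z‖ ≤ ‖∫ ξ : Plane, Complex.exp (Complex.I * ((inner ℝ z ξ : ℝ) : ℂ)) * F ξ‖ := by
  unfold fourierInvPlane
  rw [norm_mul]
  refine mul_le_of_le_one_left (norm_nonneg _) ?_
  rw [norm_div, norm_one, norm_pow, norm_mul, Complex.norm_real, Complex.norm_ofNat,
    Real.norm_of_nonneg Real.pi_pos.le]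
  refine div_le_one_of_le₀ (one_le_pow₀ ?_) (by positivity)
  linarith [Real.pi_gt_three]

theorem norm_exp_I_mul_ofReal (a : ℝ) : ‖Complex.exp (Complex.I * (a : ℂ))‖ = 1 := by
  rw [mul_comm]; exact Complex.norm_exp_ofReal_mul_I a

theorem integrable_exp_inner_mul {F : Plane → ℂ} (hF : Integrable F) (z : Plane) :
    Integrable fun ξ : Plane => Complex.exp (Complex.I * ((inner ℝ z ξ : ℝ) : ℂ)) * F ξ :=
  hF.bdd_mul (c := 1) (Continuous.aestronglyMeasurable (by fun_prop))
    (Filter.Eventually.of_forall fun ξ => (norm_exp_I_mul_ofReal _).le)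

theorem norm_fourierInvPlane_le_integral_norm {F : Plane → ℂ} (z : Plane) :
    ‖fourierInvPlane F z‖ ≤ ∫ ξ, ‖F ξ‖ := by
  refine (norm_fourierInvPlane_le z).trans ((norm_integral_le_integral_norm _).trans (le_of_eq ?_))
  congr 1; ext ξ
  rw [norm_mul, norm_exp_I_mul_ofReal, one_mul]

theorem continuous_fourierInvPlane {F : Plane → ℂ} (hF : Integrable F) :
    Continuous (fourierInvPlane F) := by
  unfold fourierInvPlane
  refine continuous_const.mul (continuous_of_dominated (bound := fun ξ => ‖F ξ‖)
    (fun z => (integrable_exp_inner_mul hF z).aestronglyMeasurable)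
    (fun z => Filter.Eventually.of_forall fun ξ => ?_) hF.norm
    (Filter.Eventually.of_forall fun ξ => by fun_prop))
  rw [norm_mul, norm_exp_I_mul_ofReal, one_mul]

/-- Decay along the first coordinate axis. -/
theorem enorm_fourierInvPlane_axis_le (hγ : 0 < γ) (hf2 : f ∈ gaussianLp γ 2)
    (hf1 : f ∈ gaussianLp γ 1) {lam : ℝ} (hlam : lam ≠ 0)
    (hv : ∀ ξ : Plane, ‖ξ‖ = |lam| → fourierPlane f ξ = 0) {r : ℝ} (hr : 1 / (2 * γ) ≤ r) :
    ‖fourierInvPlane (fun ξ : Plane => fourierPlane f ξ / ((‖ξ‖ ^ 2 - lam ^ 2 : ℝ) : ℂ))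
      !₂[r, 0]‖ₑ ≤ ENNReal.ofReal (Real.exp (-(γ * r ^ 2))) *
        shiftConst lam (gaussianNormOne γ f) (gaussianNormTwoSq γ f) := by
  -- The minimiser of -rη + η²/(4γ), with minimum -γr²; the lower bound on r is what makes η ≥ 1.
  set η := 2 * γ * r with hη
  have hη1 : 1 ≤ η := by
    rw [div_le_iff₀ (by positivity)] at hr
    linarith
  have hr0 : 0 ≤ r := le_trans (by positivity) hr
  have hint := integrable_exp_inner_mul (integrable_fourierPlane_div hγ hf2 hf1 hlam hv) !₂[r, 0]
  have h1 := enorm_le_iff_norm_le.2 (norm_fourierInvPlane_le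
    (F := fun ξ : Plane => fourierPlane f ξ / ((‖ξ‖ ^ 2 - lam ^ 2 : ℝ) : ℂ)) !₂[r, 0])
  rw [integral_plane_eq hint] at h1
  have hin : ∀ t x : ℝ, Complex.exp (Complex.I * ((inner ℝ !₂[r, 0] !₂[x, t] : ℝ) : ℂ)) *
      (fourierPlane f !₂[x, t] / ((‖(!₂[x, t] : Plane)‖ ^ 2 - lam ^ 2 : ℝ) : ℂ)) =
      Complex.exp (Complex.I * (r * x : ℂ)) *
        (planeExt f x t / ((x : ℂ) ^ 2 + t ^ 2 - lam ^ 2)) := by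
    intro t x
    rw [fourierPlane_eq_planeExt, Plane.norm_sq_eq, Plane.inner_eq]
    simp
  simp_rw [hin] at h1
  refine h1.trans ((enorm_integral_le_lintegral_enorm _).trans ?_)
  have h2 : ∫⁻ t : ℝ, ‖∫ x : ℝ, Complex.exp (Complex.I * (r * x : ℂ)) *
        (planeExt f x t / ((x : ℂ) ^ 2 + t ^ 2 - lam ^ 2))‖ₑ ≤
      ∫⁻ t : ℝ, ENNReal.ofReal (Real.exp (-(r * η))) * ∫⁻ x : ℝ,
        ‖planeExt f (x + η * Complex.I) t /
          ((x + η * Complex.I : ℂ) ^ 2 + t ^ 2 - lam ^ 2)‖ₑ := by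
    refine lintegral_mono_ae ?_
    filter_upwards [Measure.ae_ne volume lam, Measure.ae_ne volume (-lam)] with t h1 h2
    refine enorm_integral_planeExt_div_le hγ hf1 hlam hv hr0 (by linarith) ?_
    intro h
    rcases sq_eq_sq_iff_eq_or_eq_neg.1 h with h | h
    · exact h1 h
    · exact h2 h
  refine h2.trans ?_
  rw [lintegral_const_mul' _ _ ENNReal.ofReal_ne_top]
  refine (mul_le_mul_right (lintegral_planeExt_div_le hγ hf2 hf1 lam hη1) _).trans ?_
  rw [← mul_assoc, ← ENNReal.ofReal_mul (by positivity), ← Real.exp_add]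
  refine le_of_eq ?_
  congr 3
  rw [hη]
  field_simp
  ring

/-! ### Invariance under linear isometries -/

theorem integral_comp_isometry (U : Plane ≃ₗᵢ[ℝ] Plane) {G : Type*} [NormedAddCommGroup G]
    [NormedSpace ℝ G] (g : Plane → G) : ∫ z, g (U z) = ∫ z, g z :=
  U.measurePreserving.integral_comp U.toHomeomorph.measurableEmbedding g

theorem gaussianLp.comp_isometry {p : ℝ≥0∞} (hf : f ∈ gaussianLp γ p) (U : Plane ≃ₗᵢ[ℝ] Plane) :
    f ∘ U ∈ gaussianLp γ p := by
  have := MemLp.comp_measurePreserving hf U.measurePreserving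
  simpa only [Function.comp_def, U.norm_map] using! this

theorem gaussianNormOne_comp_isometry (U : Plane ≃ₗᵢ[ℝ] Plane) :
    gaussianNormOne γ (f ∘ U) = gaussianNormOne γ f := by
  unfold gaussianNormOne
  rw [← integral_comp_isometry U (fun z => Real.exp (γ * ‖z‖ ^ 2) * ‖f z‖)]
  simp only [U.norm_map, Function.comp_apply]

theorem gaussianNormTwoSq_comp_isometry (U : Plane ≃ₗᵢ[ℝ] Plane) :
    gaussianNormTwoSq γ (f ∘ U) = gaussianNormTwoSq γ f := by
  unfold gaussianNormTwoSq
  rw [← U.measurePreserving.lintegral_comp_emb U.toHomeomorph.measurableEmbedding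
    (fun z => ‖((Real.exp (γ * ‖z‖ ^ 2) : ℝ) : ℂ) * f z‖ₑ ^ 2)]
  simp only [U.norm_map, Function.comp_apply]

theorem fourierPlane_comp_isometry (U : Plane ≃ₗᵢ[ℝ] Plane) (ξ : Plane) :
    fourierPlane (f ∘ U) ξ = fourierPlane f (U ξ) := by
  unfold fourierPlane
  rw [← integral_comp_isometry U
    (fun z => Complex.exp (-Complex.I * ((inner ℝ (U ξ) z : ℝ) : ℂ)) * f z)]
  simp only [U.inner_map_map, Function.comp_apply]

theorem fourierInvPlane_comp_isometry (U : Plane ≃ₗᵢ[ℝ] Plane) (z : Plane) :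
    fourierInvPlane (f ∘ U) z = fourierInvPlane f (U z) := by
  unfold fourierInvPlane
  rw [← integral_comp_isometry U
    (fun ξ => Complex.exp (Complex.I * ((inner ℝ (U z) ξ : ℝ) : ℂ)) * f ξ)]
  simp only [U.inner_map_map, Function.comp_apply]

theorem enorm_fourierInvPlane_le (hγ : 0 < γ) (hf2 : f ∈ gaussianLp γ 2)
    (hf1 : f ∈ gaussianLp γ 1) {lam : ℝ} (hlam : lam ≠ 0)
    (hv : ∀ ξ : Plane, ‖ξ‖ = |lam| → fourierPlane f ξ = 0) {z : Plane}
    (hz : 1 / (2 * γ) ≤ ‖z‖) :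
    ‖fourierInvPlane (fun ξ : Plane => fourierPlane f ξ / ((‖ξ‖ ^ 2 - lam ^ 2 : ℝ) : ℂ)) z‖ₑ ≤
      ENNReal.ofReal (Real.exp (-(γ * ‖z‖ ^ 2))) *
        shiftConst lam (gaussianNormOne γ f) (gaussianNormTwoSq γ f) := by
  have hn : ‖(!₂[‖z‖, 0] : Plane)‖ = ‖z‖ := by
    rw [Plane.norm_eq]; simp
  -- The reflection exchanging (‖z‖, 0) and z; if they coincide, the subspace is the whole plane and
  -- U is the identity.
  set U : Plane ≃ₗᵢ[ℝ] Plane := (Submodule.span ℝ {!₂[‖z‖, 0] - z})ᗮ.reflection with hU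
  have hUz : U !₂[‖z‖, 0] = z := Submodule.reflection_sub hn
  have h := enorm_fourierInvPlane_axis_le hγ (gaussianLp.comp_isometry hf2 U)
    (gaussianLp.comp_isometry hf1 U) hlam
    (fun ξ hξ => by rw [fourierPlane_comp_isometry]; exact hv _ (by rw [U.norm_map, hξ])) hz
  rw [gaussianNormOne_comp_isometry, gaussianNormTwoSq_comp_isometry] at h
  have e : (fun ξ : Plane => fourierPlane (f ∘ U) ξ / ((‖ξ‖ ^ 2 - lam ^ 2 : ℝ) : ℂ)) =
      (fun ξ : Plane => fourierPlane f ξ / ((‖ξ‖ ^ 2 - lam ^ 2 : ℝ) : ℂ)) ∘ U := by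
    ext ξ
    simp only [fourierPlane_comp_isometry, Function.comp_apply, U.norm_map]
  rwa [e, fourierInvPlane_comp_isometry, hUz] at h

end

/-- If `f ∈ e^{-γ|z|²}L² ∩ e^{-γ|z|²}L¹` has a Fourier transform that vanishes on the circle
`|ξ| = |lam|`, then `f̂(ξ) / (|ξ|² - lam²)`, which is defined off that null set, is integrable,
and its inverse Fourier transform is in `e^{-γ|z|²}L^∞`. -/
theorem corollary6p3 (γ : ℝ) (hγ : 0 < γ) (lam : ℝ) (hlam : lam ≠ 0) (f : Plane → ℂ)
    (hf2 : f ∈ gaussianLp γ 2) (hf1 : f ∈ gaussianLp γ 1)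
    (hvanish : ∀ ξ : Plane, ‖ξ‖ = |lam| → fourierPlane f ξ = 0) :
    Integrable (fun ξ : Plane => fourierPlane f ξ / ((‖ξ‖ ^ 2 - lam ^ 2 : ℝ) : ℂ)) volume ∧
      fourierInvPlane (fun ξ : Plane => fourierPlane f ξ / ((‖ξ‖ ^ 2 - lam ^ 2 : ℝ) : ℂ)) ∈
        gaussianLp γ ∞ := by
  have hint := integrable_fourierPlane_div hγ hf2 hf1 hlam hvanish
  refine ⟨hint, ?_⟩
  set g := fun ξ : Plane => fourierPlane f ξ / ((‖ξ‖ ^ 2 - lam ^ 2 : ℝ) : ℂ) with hg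
  set C := shiftConst lam (gaussianNormOne γ f) (gaussianNormTwoSq γ f) with hC
  have hCtop : C ≠ ∞ := shiftConst_ne_top _ _ (gaussianNormTwoSq_ne_top hf2)
  have hcont := continuous_fourierInvPlane hint
  have hg0 : 0 ≤ ∫ ξ, ‖g ξ‖ := integral_nonneg fun ξ => norm_nonneg _
  refine memLp_top_of_bound (Continuous.aestronglyMeasurable (by fun_prop))
    (C.toReal + Real.exp (γ * (1 / (2 * γ)) ^ 2) * ∫ ξ, ‖g ξ‖)
    (Filter.Eventually.of_forall fun z => ?_)
  rw [norm_mul, Complex.norm_real, Real.norm_of_nonneg (Real.exp_pos _).le]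
  -- On the disc where η ≥ 1 is unavailable, the weight is bounded and the L¹ norm of g controls the
  -- inverse transform.
  rcases le_total (1 / (2 * γ)) ‖z‖ with hz | hz
  · have h := enorm_fourierInvPlane_le hγ hf2 hf1 hlam hvanish hz
    have h2 : ‖fourierInvPlane g z‖ ≤ Real.exp (-(γ * ‖z‖ ^ 2)) * C.toReal := by
      have := ENNReal.toReal_mono (by finiteness) h
      rwa [toReal_enorm, ENNReal.toReal_mul, ENNReal.toReal_ofReal (Real.exp_pos _).le] at this
    calc _ ≤ Real.exp (γ * ‖z‖ ^ 2) * (Real.exp (-(γ * ‖z‖ ^ 2)) * C.toReal) := by gcongr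
      _ = C.toReal := by rw [← mul_assoc, ← Real.exp_add, add_neg_cancel, Real.exp_zero, one_mul]
      _ ≤ _ := le_add_of_nonneg_right (by positivity)
  · calc _ ≤ Real.exp (γ * (1 / (2 * γ)) ^ 2) * ∫ ξ, ‖g ξ‖ := by
          gcongr
          exact norm_fourierInvPlane_le_integral_norm z
      _ ≤ _ := le_add_of_nonneg_left ENNReal.toReal_nonneg
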